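/- Summation over repeated indices is understood; lower indices on functions denote partial derivatives. **Setting.** Let $\Omega\subset\mathbb{R}^n$ be a bounded domain with smooth boundary and unit outward normal $\boldsymbol n$, in coordinates $x=(x^1,\dots,x^n)$, $dV=dx^1\cdots dx^n$. Let $\mathcal J=(\mathcal J^{ij})$ be a Poisson operator, smooth up to the boundary: $\mathcal J^{ij}=-\mathcal J^{ji}$ and $\mathcal J^{im}\mathcal J^{jk}_m+\mathcal J^{jm}\mathcal J^{ki}_m+\mathcal J^{km}\mathcal J^{ij}_m=0$. Assume that the coordinates span the invariant measure, i.e. $\partial_i\mathcal J^{ij}=0$ for all $j$. Let $H$ (the Hamiltonian) and $C^1,\dots,C^m$ be smooth up to the boundary, with $\mathcal J^{ij}C^k_j=0$. Let $D\ge 0$, $\alpha,\mu_1,\dots,\mu_m\in\mathbb R$, and let $\beta(t),\gamma(t)$ be functions of $t$ in an open set $T\subset\mathbb R$ with $2\gamma=D\beta$ (so $\beta=2\gamma/D$ if $D>0$). Let $f(t,x)>0$ be of class $C^2$ for $t\in T$ and $x$ up to the boundary of $\Omega$. Put $\dot x^i=\mathcal J^{ij}H_j$ and $Z^i=\mathcal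 J^{ij}H_j-\frac D2\mathcal J^{ik}\mathcal J^{jk}\partial_j(\log f+\beta H)$, and assume $\dot{\boldsymbol x}\cdot\boldsymbol n=\boldsymbol Z\cdot\boldsymbol n=0$ on $\partial\Omega$ for all $t\in T$. The Fokker–Planck equation is $$\frac{\partial f}{\partial t}=\partial_i\Big[-\mathcal J^{ij}H_jf+\gamma\mathcal J^{ik}\mathcal J^{jk}H_jf+\tfrac12D\,\mathcal J^{ik}\partial_j(\mathcal J^{jk}f)\Big]\quad\text{in }\Omega.\tag{FP}$$ **Brackets.** The functional derivative $\delta F/\delta f$ of a functional $F$ at a positive density is the function $g$, $C^1$ up to the boundary, with $\frac{d}{d\varepsilon}F[f+\varepsilon\eta]|_{\varepsilon=0}=\int_\Omega g\,\eta\,dV$ for all $\eta$ smooth up to the boundary; $F$ is differentiable at the density if such a $g$ exists. Put $$\{F,G\}=\int_\Omega f\,\partial_i\frac{\delta F}{\delta f}\,\mathcal J^{ij}\,\partial_j\frac{\delta G}{\delta f}\,dV,\qquad [F,G]=\frac D2\int_\Omega f\,\partial_i\frac{\delta F}{\delta f}\,\mathcal J^{ik}\mathcal J^{jk}\,\partial_j\frac{\delta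 G}{\delta f}\,dV,$$ and let $N=\int_\Omega f\,dV$, $E=\int_\Omega fH\,dV$, $\mathfrak C^k=\int_\Omega fC^k\,dV$, $S=-\int_\Omega f\log f\,dV$, $\Sigma=S-\alpha N-\beta E-\mu_k\mathfrak C^k$. In all variations and time derivatives of $\Sigma$ the multipliers $\alpha,\beta,\mu_k$ are held fixed (at their values at the time considered). For the field $f$ itself, $\{f,G\}$ and $[f,G]$ denote the distributions whose pairings with $\varphi\in C^\infty(\overline\Omega)$ are $\{F_\varphi,G\}$ and $[F_\varphi,G]$, where $F_\varphi=\int_\Omega f\varphi\,dV$. **Claim.** 1. At every positive density that is $C^1$ up to the boundary, $N$, $E$, $\mathfrak C^k$, $F_\varphi$ and $\Sigma$ are differentiable, with functional derivatives $1$, $H$, $C^k$, $\varphi$ and $-\log f-1-\alpha-\beta H-\mu_kC^k$. Moreover $N$ and each $\mathfrak C^k$ are Casimirs of both brackets: $\{N,G\}=[N,G]=\{\mathfrak C^k,G\}=[\mathfrak C^k,G]=0$ for every differentiable functional $G$. 2. For every $t\in T$, $\{f,E\}+[f,\Sigma]$ equals the right-hand side of (FP). Hence (FP) holds at time $t$ if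 and only if $\partial f/\partial t=\{f,E\}+[f,\Sigma]$ at time $t$; equivalently, if and only if $\frac{d}{dt}F_\varphi=\{F_\varphi,E\}+[F_\varphi,\Sigma]$ at time $t$ for all $\varphi\in C^\infty(\overline\Omega)$. 3. If (FP) holds at time $t$, then at that time $$\frac{dE}{dt}=\{E,E\}+[E,\Sigma]=-\frac D2\int_\Omega fH_i\mathcal J^{ik}\mathcal J^{jk}\partial_j(\log f+\beta H)\,dV.$$ If in addition $D>0$ and $\int_\Omega fH_i\mathcal J^{ik}\mathcal J^{jk}H_j\,dV\ne0$, then $dE/dt=0$ if and only if $$\beta=-\frac{\int_\Omega H_i\mathcal J^{ik}\mathcal J^{jk}f_j\,dV}{\int_\Omega fH_i\mathcal J^{ik}\mathcal J^{jk}H_j\,dV}=-\frac{\sum_i\langle\dot x^i\,\mathcal J^{ij}\partial_j\log f\rangle}{\sum_i\langle(\dot x^i)^2\rangle},\qquad\langle g\rangle=\int_\Omega fg\,dV .$$ The numerators of the two fractions are equal, and so are the denominators, also without these additional assumptions. 4. If (FP) holds at time $t$, then at that time $$\frac{d\Sigma}{dt}=\{\Sigma,E\}+[\Sigma,\Sigma]=\frac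 D2\sum_{i=1}^n\int_\Omega f\big[\mathcal J^{ij}\partial_j(\log f+\beta H)\big]^2dV\ \ge 0,$$ and if moreover $dE/dt=0$ at time $t$, then $dS/dt$ has the same value. -/

import Mathlib

open MeasureTheory Set
open scoped ContDiff

noncomputable section

namespace FokkerPlanck

/-- The coordinate space `ℝⁿ`; `volume` is `dV = dx¹ ∧ ... ∧ dxⁿ`. -/
abbrev Pt (n : ℕ) := EuclideanSpace ℝ (Fin n)

/-- The partial derivative `∂g/∂xⁱ` at `x`. -/
def pd {n : ℕ} (i : Fin n) (g : Pt n → ℝ) (x : Pt n) : ℝ :=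
  fderiv ℝ g x (EuclideanSpace.single i 1)

/-- `g` is of class `Cᵏ` up to the boundary of `Ω`, i.e. on a neighbourhood of its closure. -/
def CkUpTo {n : ℕ} (k : ℕ∞) (Ω : Set (Pt n)) (g : Pt n → ℝ) : Prop :=
  ∃ U : Set (Pt n), IsOpen U ∧ closure Ω ⊆ U ∧ ContDiffOn ℝ k g U

/-- `Ω` is a bounded domain (open, connected, nonempty) with smooth boundary, and `ρ` is a smooth
defining function of it: `Ω = {ρ < 0}` and `∇ρ ≠ 0` on `{ρ = 0}` (which is then `∂Ω`). -/
structure IsSmoothlyBoundedDomain {n : ℕ} (Ω : Set (Pt n)) (ρ : Pt n → ℝ) : Prop where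
  isOpen : IsOpen Ω
  isConnected : IsConnected Ω
  isBounded : Bornology.IsBounded Ω
  smooth : ContDiff ℝ ∞ ρ
  eq_sublevel : Ω = {x | ρ x < 0}
  regular : ∀ x, ρ x = 0 → gradient ρ x ≠ 0

/-- The unit outward normal to `∂Ω = {ρ = 0}`. -/
def outwardNormal {n : ℕ} (ρ : Pt n → ℝ) (x : Pt n) : Pt n :=
  ‖gradient ρ x‖⁻¹ • gradient ρ x

/-- `𝒥` is a Poisson operator on `Ω`: a smooth antisymmetric matrix field that satisfies the
Jacobi identity. -/
structure IsPoissonOperator {n : ℕ} (Ω : Set (Pt n))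
    (𝒥 : Pt n → Matrix (Fin n) (Fin n) ℝ) : Prop where
  smooth : ∀ i j, CkUpTo ⊤ Ω (fun x => 𝒥 x i j)
  antisymm : ∀ x ∈ Ω, ∀ i j, 𝒥 x i j = -𝒥 x j i
  jacobi : ∀ x ∈ Ω, ∀ i j k,
    ∑ l, (𝒥 x i l * pd l (fun y => 𝒥 y j k) x + 𝒥 x j l * pd l (fun y => 𝒥 y k i) x
      + 𝒥 x k l * pd l (fun y => 𝒥 y i j) x) = 0

/-- The coordinates span the invariant measure (`J = 1`): `∑ᵢ ∂ᵢ 𝒥ⁱʲ = 0` on `Ω`. -/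
def IsDivFree {n : ℕ} (Ω : Set (Pt n)) (𝒥 : Pt n → Matrix (Fin n) (Fin n) ℝ) : Prop :=
  ∀ x ∈ Ω, ∀ j, ∑ i, pd i (fun y => 𝒥 y i j) x = 0

/-- `C` is a Casimir invariant of `𝒥` on `Ω`. -/
def IsMicroCasimir {n : ℕ} (Ω : Set (Pt n)) (𝒥 : Pt n → Matrix (Fin n) (Fin n) ℝ)
    (C : Pt n → ℝ) : Prop :=
  ∀ x ∈ Ω, ∀ i, ∑ j, 𝒥 x i j * pd j C x = 0

/-- The dissipative tensor `𝒥ⁱᵏ 𝒥ʲᵏ` (summed over `k`). -/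
def dissTensor {n : ℕ} (𝒥 : Pt n → Matrix (Fin n) (Fin n) ℝ) (x : Pt n) (i j : Fin n) : ℝ :=
  ∑ k, 𝒥 x i k * 𝒥 x j k

/-- The unperturbed velocity `ẋⁱ = 𝒥ⁱʲ Hⱼ`. -/
def velocity {n : ℕ} (𝒥 : Pt n → Matrix (Fin n) (Fin n) ℝ) (H : Pt n → ℝ) (x : Pt n) : Pt n :=
  WithLp.toLp 2 fun i => ∑ j, 𝒥 x i j * pd j H x

/-- The Fokker–Planck velocity `Zⁱ = 𝒥ⁱʲ Hⱼ - (D/2) 𝒥ⁱᵏ 𝒥ʲᵏ ∂ⱼ (log u + β H)`. -/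
def fpVelocity {n : ℕ} (𝒥 : Pt n → Matrix (Fin n) (Fin n) ℝ) (H : Pt n → ℝ) (D β : ℝ)
    (u : Pt n → ℝ) (x : Pt n) : Pt n :=
  WithLp.toLp 2 fun i => ∑ j, 𝒥 x i j * pd j H x
    - D / 2 * ∑ j, dissTensor 𝒥 x i j * pd j (fun y => Real.log (u y) + β * H y) x

/-- The right-hand side of the Fokker–Planck equation,
`∂ᵢ [-𝒥ⁱʲ Hⱼ u + γ 𝒥ⁱᵏ 𝒥ʲᵏ Hⱼ u + (D/2) 𝒥ⁱᵏ ∂ⱼ (𝒥ʲᵏ u)]`. -/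
def fpRHS {n : ℕ} (𝒥 : Pt n → Matrix (Fin n) (Fin n) ℝ) (H : Pt n → ℝ) (D γ : ℝ)
    (u : Pt n → ℝ) (x : Pt n) : ℝ :=
  ∑ i, pd i (fun y =>
    -(∑ j, 𝒥 y i j * pd j H y * u y)
      + γ * ∑ j, dissTensor 𝒥 y i j * pd j H y * u y
      + 1 / 2 * D * ∑ k, 𝒥 y i k * ∑ j, pd j (fun z => 𝒥 z j k * u z) y) x

/-- A time-dependent density `f` solves the Fokker–Planck equation on `Ω` at time `t`. -/
def SolvesFPAt {n : ℕ} (Ω : Set (Pt n)) (𝒥 : Pt n → Matrix (Fin n) (Fin n) ℝ) (H : Pt n → ℝ)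
    (D γ : ℝ) (f : ℝ → Pt n → ℝ) (t : ℝ) : Prop :=
  ∀ x ∈ Ω, HasDerivAt (fun s => f s x) (fpRHS 𝒥 H D γ (f t) x) t

/-! ### Functionals and macroscopic brackets -/

/-- Positive densities, of class `C¹` up to the boundary. -/
def IsDensity {n : ℕ} (Ω : Set (Pt n)) (u : Pt n → ℝ) : Prop :=
  CkUpTo 1 Ω u ∧ ∀ x ∈ closure Ω, 0 < u x

/-- `g` (of class `C¹` up to the boundary) is the functional derivative `δF/δf` at `u`:
`d/dε F[u + ε η] = ∫_Ω g η dV` at `ε = 0`, for every variation `η` that is smooth up to the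
boundary. Such a `g` is unique on `Ω`. -/
def HasFunctionalDeriv {n : ℕ} (Ω : Set (Pt n)) (F : (Pt n → ℝ) → ℝ) (u g : Pt n → ℝ) : Prop :=
  CkUpTo 1 Ω g ∧ ∀ η : Pt n → ℝ, CkUpTo ⊤ Ω η →
    HasDerivAt (fun ε : ℝ => F (fun x => u x + ε * η x)) (∫ x in Ω, g x * η x) 0

/-- `F` is a differentiable functional at `u`. -/
def FunctionalDifferentiableAt {n : ℕ} (Ω : Set (Pt n)) (F : (Pt n → ℝ) → ℝ)
    (u : Pt n → ℝ) : Prop :=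
  ∃ g, HasFunctionalDeriv Ω F u g

open Classical in
/-- The functional derivative `δF/δf` at `u` (zero if there is none). -/
def functionalDeriv {n : ℕ} (Ω : Set (Pt n)) (F : (Pt n → ℝ) → ℝ) (u : Pt n → ℝ) : Pt n → ℝ :=
  if h : FunctionalDifferentiableAt Ω F u then Classical.choose h else 0

/-- The macroscopic Poisson bracket `{F, G}` evaluated at the density `u`. -/
def poissonBracket {n : ℕ} (Ω : Set (Pt n)) (𝒥 : Pt n → Matrix (Fin n) (Fin n) ℝ)
    (F G : (Pt n → ℝ) → ℝ) (u : Pt n → ℝ) : ℝ :=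
  ∫ x in Ω, u x * ∑ i, ∑ j,
    pd i (functionalDeriv Ω F u) x * 𝒥 x i j * pd j (functionalDeriv Ω G u) x

/-- The macroscopic dissipative bracket `[F, G]` evaluated at the density `u`. -/
def dissipativeBracket {n : ℕ} (Ω : Set (Pt n)) (𝒥 : Pt n → Matrix (Fin n) (Fin n) ℝ) (D : ℝ)
    (F G : (Pt n → ℝ) → ℝ) (u : Pt n → ℝ) : ℝ :=
  D / 2 * ∫ x in Ω, u x * ∑ i, ∑ j,
    pd i (functionalDeriv Ω F u) x * dissTensor 𝒥 x i j * pd j (functionalDeriv Ω G u) x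

/-- The metriplectic bracket `(F, G, K) = {F, G} + [F, K]` evaluated at the density `u`. -/
def metriplecticBracket {n : ℕ} (Ω : Set (Pt n)) (𝒥 : Pt n → Matrix (Fin n) (Fin n) ℝ) (D : ℝ)
    (F G K : (Pt n → ℝ) → ℝ) (u : Pt n → ℝ) : ℝ :=
  poissonBracket Ω 𝒥 F G u + dissipativeBracket Ω 𝒥 D F K u

/-- The differentiable functional `F` is a Casimir invariant of the bracket `B`: at every
density, `B(F, G) = 0` for every differentiable functional `G`. -/
def IsMacroCasimir {n : ℕ} (Ω : Set (Pt n))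
    (B : ((Pt n → ℝ) → ℝ) → ((Pt n → ℝ) → ℝ) → (Pt n → ℝ) → ℝ)
    (F : (Pt n → ℝ) → ℝ) : Prop :=
  ∀ u, IsDensity Ω u → FunctionalDifferentiableAt Ω F u ∧
    ∀ G, FunctionalDifferentiableAt Ω G u → B F G u = 0

/-- The linear observable `u ↦ ∫_Ω u φ dV`. -/
def linearObs {n : ℕ} (Ω : Set (Pt n)) (φ : Pt n → ℝ) (u : Pt n → ℝ) : ℝ :=
  ∫ x in Ω, u x * φ x

/-- The total particle number `N`. -/
def totalNumber {n : ℕ} (Ω : Set (Pt n)) (u : Pt n → ℝ) : ℝ := ∫ x in Ω, u x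

/-- The total energy `E`. -/
def totalEnergy {n : ℕ} (Ω : Set (Pt n)) (H : Pt n → ℝ) : (Pt n → ℝ) → ℝ := linearObs Ω H

/-- The total Casimir invariant `∫_Ω u C dV`. -/
def totalCasimir {n : ℕ} (Ω : Set (Pt n)) (C : Pt n → ℝ) : (Pt n → ℝ) → ℝ := linearObs Ω C

/-- Shannon's entropy `S`. -/
def entropy {n : ℕ} (Ω : Set (Pt n)) (u : Pt n → ℝ) : ℝ :=
  -∫ x in Ω, u x * Real.log (u x)

/-- The constrained entropy `Σ = S - α N - β E - μₖ ℭᵏ`; the multipliers are parameters, so that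
variations of it are variations at fixed `β`. -/
def constrainedEntropy {n m : ℕ} (Ω : Set (Pt n)) (H : Pt n → ℝ) (C : Fin m → Pt n → ℝ)
    (α β : ℝ) (μ : Fin m → ℝ) (u : Pt n → ℝ) : ℝ :=
  entropy Ω u - α * totalNumber Ω u - β * totalEnergy Ω H u
    - ∑ k, μ k * totalCasimir Ω (C k) u

/-- The function `w` on `Ω` is the field-valued bracket `(f, G, K) = {f, G} + [f, K]` at the
density `u`. Here `f` stands for the density itself, whose functional derivative is the Dirac
distribution, so that the bracket is the distribution that pairs with `φ` to the bracket of the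
smeared field `∫_Ω f φ dV`. -/
def IsFieldBracket {n : ℕ} (Ω : Set (Pt n)) (𝒥 : Pt n → Matrix (Fin n) (Fin n) ℝ) (D : ℝ)
    (G K : (Pt n → ℝ) → ℝ) (u w : Pt n → ℝ) : Prop :=
  ∀ φ : Pt n → ℝ, CkUpTo ⊤ Ω φ →
    metriplecticBracket Ω 𝒥 D (linearObs Ω φ) G K u = ∫ x in Ω, w x * φ x

/-! ### Energy and entropy rates -/

/-- The numerator `∫_Ω Hᵢ 𝒥ⁱᵏ 𝒥ʲᵏ uⱼ dV` in the formula for the inverse temperature. -/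
def betaNum {n : ℕ} (Ω : Set (Pt n)) (𝒥 : Pt n → Matrix (Fin n) (Fin n) ℝ) (H : Pt n → ℝ)
    (u : Pt n → ℝ) : ℝ :=
  ∫ x in Ω, ∑ i, ∑ j, pd i H x * dissTensor 𝒥 x i j * pd j u x

/-- The denominator `∫_Ω u Hᵢ 𝒥ⁱᵏ 𝒥ʲᵏ Hⱼ dV` in the formula for the inverse temperature. -/
def betaDen {n : ℕ} (Ω : Set (Pt n)) (𝒥 : Pt n → Matrix (Fin n) (Fin n) ℝ) (H : Pt n → ℝ)
    (u : Pt n → ℝ) : ℝ :=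
  ∫ x in Ω, u x * ∑ i, ∑ j, pd i H x * dissTensor 𝒥 x i j * pd j H x

/-- The ensemble average `⟨g⟩ = ∫_Ω u g dV`. -/
def ensembleAvg {n : ℕ} (Ω : Set (Pt n)) (u g : Pt n → ℝ) : ℝ := ∫ x in Ω, u x * g x

/-- `-(D/2) ∫_Ω u Hᵢ 𝒥ⁱᵏ 𝒥ʲᵏ ∂ⱼ (log u + β H) dV`. -/
def energyRate {n : ℕ} (Ω : Set (Pt n)) (𝒥 : Pt n → Matrix (Fin n) (Fin n) ℝ) (H : Pt n → ℝ)
    (D β : ℝ) (u : Pt n → ℝ) : ℝ :=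
  -(D / 2) * ∫ x in Ω, u x * ∑ i, ∑ j,
    pd i H x * dissTensor 𝒥 x i j * pd j (fun y => Real.log (u y) + β * H y) x

/-- `(D/2) ∑ᵢ ∫_Ω u [𝒥ⁱʲ ∂ⱼ (log u + β H)]² dV`. -/
def entropyRate {n : ℕ} (Ω : Set (Pt n)) (𝒥 : Pt n → Matrix (Fin n) (Fin n) ℝ) (H : Pt n → ℝ)
    (D β : ℝ) (u : Pt n → ℝ) : ℝ :=
  1 / 2 * D * ∑ i, ∫ x in Ω,
    u x * (∑ j, 𝒥 x i j * pd j (fun y => Real.log (u y) + β * H y) x) ^ 2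

end FokkerPlanck

end

/-!
The density is transported: on `Ω` the Fokker–Planck equation reads `∂f/∂t = -∂ᵢ (f Zⁱ)`, because
`∂ᵢ 𝒥ⁱʲ = 0` and `2 γ = D β` (`IsInvariantSystem.fpRHS_eq`). On the other side, the Casimir part of
`δΣ/δf` is annihilated by `𝒥`, so that `{F, E} + [F, Σ] = ∫ f ∂ᵢ(δF/δf) Zⁱ dV` for every
differentiable functional `F` (`IsInvariantSystem.metriplecticBracket_eq`). Since `Z` is tangential
on the boundary, the two expressions are related by an integration by parts without boundary term
(`IsInvariantSystem.integral_fpRHS_mul`). This needs only that `δF/δf` is `C¹`, so it applies to the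
smeared fields, to `E` and to `Σ` itself; the claims on `∂f/∂t` follow since smooth test functions
separate continuous functions.

The energy and entropy rates are then pointwise algebra: `𝒥` is antisymmetric and `𝒥ⁱᵏ 𝒥ʲᵏ` is the
Gram matrix `𝒥ᵀ 𝒥`. The one integral that does not vanish pointwise, `∫ ẋ · ∇f dV` in `{Σ, E}`, is
zero because `ẋ` is divergence free and tangential.

Two analytic facts carry this. The divergence theorem for tangential fields,
`IsSmoothlyBoundedDomain.integral_div_eq_zero`, is proved by cutting off in a boundary layer: the
defining function `ρ` has nonzero gradient on `∂Ω`, so `W · ∇ρ = O(ρ)` for a `C¹` tangential field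
`W`, and this compensates the gradient of the cutoff. Differentiation under the integral sign for
jointly `C¹` families, `IsC1FamilyAt.hasDerivAt_integral`, gives both the functional derivatives
(family `u + ε η`) and the time derivatives (family `f s`).
-/

namespace FokkerPlanck

open Filter Topology

variable {n : ℕ} {Ω : Set (Pt n)} {ρ : Pt n → ℝ}

/-! ### Partial derivatives and regularity up to the boundary -/

section Calculus

variable {g h : Pt n → ℝ} {x : Pt n}

lemma pd_congr (hgh : g =ᶠ[𝓝 x] h) (i : Fin n) : pd i g x = pd i h x := by
  simp only [pd, hgh.fderiv_eq]

lemma pd_congr_of_eqOn (hΩ : IsOpen Ω) (hgh : EqOn g h Ω) (hx : x ∈ Ω) (i : Fin n) :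
    pd i g x = pd i h x :=
  pd_congr (hgh.eventuallyEq_of_mem (hΩ.mem_nhds hx)) i

@[simp] lemma pd_const (c : ℝ) (i : Fin n) : pd i (fun _ => c) x = 0 := by simp [pd]

lemma pd_add (hg : DifferentiableAt ℝ g x) (hh : DifferentiableAt ℝ h x) (i : Fin n) :
    pd i (fun y => g y + h y) x = pd i g x + pd i h x := by
  simp [pd, fderiv_fun_add hg hh]

lemma pd_sub (hg : DifferentiableAt ℝ g x) (hh : DifferentiableAt ℝ h x) (i : Fin n) :
    pd i (fun y => g y - h y) x = pd i g x - pd i h x := by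
  simp [pd, fderiv_fun_sub hg hh]

lemma pd_neg (i : Fin n) : pd i (fun y => -g y) x = -pd i g x := by
  simp [pd, fderiv_fun_neg]

lemma pd_mul (hg : DifferentiableAt ℝ g x) (hh : DifferentiableAt ℝ h x) (i : Fin n) :
    pd i (fun y => g y * h y) x = g x * pd i h x + h x * pd i g x := by
  simp [pd, fderiv_fun_mul hg hh]

lemma pd_const_mul (hg : DifferentiableAt ℝ g x) (c : ℝ) (i : Fin n) :
    pd i (fun y => c * g y) x = c * pd i g x := by
  simp [pd, fderiv_const_mul hg]

lemma pd_sum {ι : Type*} {s : Finset ι} {g : ι → Pt n → ℝ}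
    (hg : ∀ k ∈ s, DifferentiableAt ℝ (g k) x) (i : Fin n) :
    pd i (fun y => ∑ k ∈ s, g k y) x = ∑ k ∈ s, pd i (g k) x := by
  simp [pd, fderiv_fun_sum hg]

lemma pd_log (hg : DifferentiableAt ℝ g x) (hx : g x ≠ 0) (i : Fin n) :
    pd i (fun y => Real.log (g y)) x = (g x)⁻¹ * pd i g x := by
  simp [pd, fderiv.log hg hx]

lemma contDiffAt_pd {k l : ℕ∞ω} (hg : ContDiffAt ℝ l g x) (hkl : k + 1 ≤ l) (i : Fin n) :
    ContDiffAt ℝ k (pd i g) x :=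
  (hg.fderiv_right hkl).clm_apply contDiffAt_const

lemma pd_comm (hg : ContDiffAt ℝ 2 g x) (i j : Fin n) :
    pd i (pd j g) x = pd j (pd i g) x := by
  have h1 : DifferentiableAt ℝ (fderiv ℝ g) x :=
    (hg.fderiv_right (m := 1) (by norm_num)).differentiableAt (by norm_num)
  have key (a b : Fin n) : pd a (pd b g) x =
      fderiv ℝ (fderiv ℝ g) x (EuclideanSpace.single a 1) (EuclideanSpace.single b 1) := by
    change fderiv ℝ (fun y => fderiv ℝ g y (EuclideanSpace.single b 1)) x _ = _
    rw [fderiv_clm_apply h1 (differentiableAt_const _)]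
    simp
  rw [key, key]
  exact (hg.isSymmSndFDerivAt (by simp)) _ _

lemma CkUpTo.contDiffAt {k : ℕ∞} (hg : CkUpTo k Ω g) (hx : x ∈ closure Ω) :
    ContDiffAt ℝ k g x := by
  obtain ⟨U, hU, hΩU, hgU⟩ := hg
  exact hgU.contDiffAt (hU.mem_nhds (hΩU hx))

/-- For finite `k`, being `Cᵏ` on a neighbourhood of `closure Ω` is a pointwise condition, because
the set of points at which a function is `Cᵏ` is open. -/
lemma ckUpTo_of_contDiffAt {k : ℕ} (hg : ∀ x ∈ closure Ω, ContDiffAt ℝ k g x) :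
    CkUpTo k Ω g := by
  refine ⟨{x | ContDiffAt ℝ k g x}, ?_, hg, fun x hx => ContDiffAt.contDiffWithinAt hx⟩
  exact isOpen_iff_mem_nhds.2 fun x hx => ContDiffAt.eventually hx (by simp)

lemma ckUpTo_of_contDiff {k : ℕ∞} (hg : ContDiff ℝ k g) : CkUpTo k Ω g :=
  ⟨univ, isOpen_univ, subset_univ _, hg.contDiffOn⟩

end Calculus

/-! ### Smoothly bounded domains -/

namespace IsSmoothlyBoundedDomain

lemma isCompact_closure (hΩ : IsSmoothlyBoundedDomain Ω ρ) : IsCompact (closure Ω) :=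
  hΩ.isBounded.isCompact_closure

lemma mem_iff (hΩ : IsSmoothlyBoundedDomain Ω ρ) {x : Pt n} : x ∈ Ω ↔ ρ x < 0 := by
  conv_lhs => rw [hΩ.eq_sublevel]
  rfl

lemma continuous (hΩ : IsSmoothlyBoundedDomain Ω ρ) : Continuous ρ := hΩ.smooth.continuous

lemma nonpos_of_mem_closure (hΩ : IsSmoothlyBoundedDomain Ω ρ) {x : Pt n}
    (hx : x ∈ closure Ω) : ρ x ≤ 0 :=
  closure_minimal (fun _ hy => (hΩ.mem_iff.1 hy).le)
    (isClosed_le hΩ.continuous continuous_const) hx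

lemma fderiv_ne_zero (hΩ : IsSmoothlyBoundedDomain Ω ρ) {x : Pt n} (hx : ρ x = 0) :
    fderiv ℝ ρ x ≠ 0 := fun h => hΩ.regular x hx (by simp [gradient, h])

lemma mem_frontier_of_eq_zero (hΩ : IsSmoothlyBoundedDomain Ω ρ) {x : Pt n} (hx : ρ x = 0) :
    x ∈ frontier Ω := by
  rw [hΩ.isOpen.frontier_eq]
  refine ⟨?_, fun h => (hΩ.mem_iff.1 h).ne hx⟩
  by_contra hcl
  refine hΩ.fderiv_ne_zero hx (IsLocalMin.fderiv_eq_zero ?_)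
  filter_upwards [isClosed_closure.isOpen_compl.mem_nhds hcl] with y hy
  rw [hx]
  exact not_lt.1 fun h => hy (subset_closure (hΩ.mem_iff.2 h))

lemma integrableOn (hΩ : IsSmoothlyBoundedDomain Ω ρ) {g : Pt n → ℝ}
    (hg : ∀ x ∈ closure Ω, ContinuousAt g x) : IntegrableOn g Ω :=
  (ContinuousOn.integrableOn_compact hΩ.isCompact_closure
    fun x hx => (hg x hx).continuousWithinAt).mono_set subset_closure

end IsSmoothlyBoundedDomain

/-! ### The divergence theorem for tangential fields -/

/-- A function that vanishes on the smooth hypersurface `{ρ = 0}` is `O(ρ)` near it, from the side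
`ρ < 0`: a point close to the hypersurface is moved onto it along a fixed transversal direction,
over a distance of at most a multiple of `|ρ|`. -/
lemma exists_eventually_abs_le_of_eq_zero (hρ : Continuous ρ) {g : Pt n → ℝ} {p : Pt n}
    (hρp : ContDiffAt ℝ 1 ρ p) (hp : ρ p = 0) (hd : fderiv ℝ ρ p ≠ 0)
    (hg : ContDiffAt ℝ 1 g p) (hzero : ∀ y, ρ y = 0 → g y = 0) :
    ∃ K, ∀ᶠ x in 𝓝 p, ρ x < 0 → |g x| ≤ K * -ρ x := by
  obtain ⟨w, hw⟩ : ∃ w, fderiv ℝ ρ p w ≠ 0 := by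
    by_contra! h
    exact hd (ContinuousLinearMap.ext h)
  obtain ⟨v, hv⟩ : ∃ v, fderiv ℝ ρ p v = 1 :=
    ⟨(fderiv ℝ ρ p w)⁻¹ • w, by simp [hw]⟩
  have hv0 : 0 < ‖v‖ := norm_pos_iff.2 fun h => by simp [h] at hv
  obtain ⟨K, t, ht, hK⟩ := hg.exists_lipschitzOnWith
  have hst := (hρp.hasStrictFDerivAt (by norm_num)).isLittleO.def
    (c := 1 / (2 * ‖v‖)) (by positivity)
  refine ⟨K * (2 * ‖v‖), ?_⟩
  rw [nhds_prod_eq] at hst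
  obtain ⟨s, hs, hst⟩ := mem_prod_same_iff.1 hst
  obtain ⟨r, hr, hball⟩ := Metric.mem_nhds_iff.1 (inter_mem ht hs)
  have hcont : ∀ᶠ x in 𝓝 p, ‖x - p‖ + 2 * |ρ x| * ‖v‖ < r := by
    have : ContinuousAt (fun x => ‖x - p‖ + 2 * |ρ x| * ‖v‖) p := by fun_prop
    exact this.eventually_lt continuousAt_const (by simpa [hp] using hr)
  filter_upwards [hcont] with x hx hneg
  rw [abs_of_neg hneg] at hx
  have hmem (a : ℝ) (ha : 0 ≤ a) (ha' : a ≤ 2 * -ρ x) : x + a • v ∈ t ∩ s := by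
    apply hball
    rw [Metric.mem_ball, dist_eq_norm, add_sub_right_comm]
    calc ‖x - p + a • v‖ ≤ ‖x - p‖ + ‖a • v‖ := norm_add_le _ _
      _ = ‖x - p‖ + a * ‖v‖ := by rw [norm_smul, Real.norm_of_nonneg ha]
      _ ≤ ‖x - p‖ + 2 * -ρ x * ‖v‖ := by gcongr
      _ < r := hx
  have hx0 : x ∈ t ∩ s := by simpa using hmem 0 le_rfl (by linarith)
  -- `ρ` grows along `v` at a rate of at least `1 / 2`, so a step `2 |ρ x|` reaches `ρ ≥ 0`
  have hpos : 0 ≤ ρ (x + (2 * -ρ x) • v) := by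
    have h1 : ‖ρ (x + (2 * -ρ x) • v) - ρ x - fderiv ℝ ρ p (x + (2 * -ρ x) • v - x)‖
        ≤ 1 / (2 * ‖v‖) * ‖x + (2 * -ρ x) • v - x‖ :=
      hst (mk_mem_prod (hmem (2 * -ρ x) (by linarith) le_rfl).2 hx0.2)
    have h2 : ‖(2 * -ρ x) • v‖ = 2 * -ρ x * ‖v‖ := by
      rw [norm_smul, Real.norm_of_nonneg (by linarith)]
    simp only [add_sub_cancel_left, map_smul, hv, h2, smul_eq_mul, mul_one] at h1
    -- the constant `1 / (2 ‖v‖)` in the strict derivative makes the error half of the increment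
    have h3 : 1 / (2 * ‖v‖) * (2 * -ρ x * ‖v‖) = -ρ x := by field_simp
    rw [h3] at h1
    have := (abs_le.1 (Real.norm_eq_abs _ ▸ h1)).1
    linarith
  obtain ⟨a, ⟨ha0, ha1⟩, ha⟩ : (0 : ℝ) ∈ (fun a : ℝ => ρ (x + a • v)) '' Icc 0 (2 * -ρ x) :=
    intermediate_value_Icc (by linarith) (by fun_prop) ⟨by simpa using hneg.le, hpos⟩
  have hL := hK.dist_le_mul _ hx0.1 _ (hmem a ha0 ha1).1
  rw [hzero _ ha, Real.dist_eq, sub_zero, dist_eq_norm, sub_add_cancel_left, norm_neg, norm_smul,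
    Real.norm_of_nonneg ha0] at hL
  calc |g x| ≤ K * (a * ‖v‖) := hL
    _ ≤ K * (2 * -ρ x * ‖v‖) := by gcongr
    _ = K * (2 * ‖v‖) * -ρ x := by ring

lemma IsSmoothlyBoundedDomain.exists_abs_le (hΩ : IsSmoothlyBoundedDomain Ω ρ) {g : Pt n → ℝ}
    (hg : ∀ x ∈ closure Ω, ContDiffAt ℝ 1 g x) (hzero : ∀ y ∈ frontier Ω, g y = 0) :
    ∃ K, ∀ x ∈ Ω, |g x| ≤ K * -ρ x := by
  have key : ∃ K, ∀ x ∈ closure Ω, ρ x < 0 → |g x| ≤ K * -ρ x := by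
    refine hΩ.isCompact_closure.induction_on
      (p := fun s => ∃ K, ∀ x ∈ s, ρ x < 0 → |g x| ≤ K * -ρ x) ⟨0, by simp⟩
      (fun s t hst ⟨K, hK⟩ => ⟨K, fun x hx => hK x (hst hx)⟩) ?_ ?_
    · rintro s t ⟨K, hK⟩ ⟨L, hL⟩
      refine ⟨max K L, fun x hx hneg => ?_⟩
      have h0 : 0 ≤ -ρ x := by linarith
      rcases hx with hx | hx
      · exact (hK x hx hneg).trans (by gcongr; exact le_max_left _ _)
      · exact (hL x hx hneg).trans (by gcongr; exact le_max_right _ _)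
    · intro p hp
      suffices h : ∃ K, ∀ᶠ x in 𝓝 p, ρ x < 0 → |g x| ≤ K * -ρ x by
        obtain ⟨K, hK⟩ := h
        exact ⟨_, mem_nhdsWithin_of_mem_nhds hK, K, fun x hx => hx⟩
      rcases (hΩ.nonpos_of_mem_closure hp).lt_or_eq with hneg | h0
      · have hρc := hΩ.continuous.continuousAt (x := p)
        have hc : ContinuousAt (fun x => |g x| / -ρ x) p :=
          (hg p hp).continuousAt.abs.div hρc.neg (by linarith)
        refine ⟨|g p| / -ρ p + 1, ?_⟩
        filter_upwards [hc.eventually_lt continuousAt_const (lt_add_one _)] with x hx hxneg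
        exact (div_le_iff₀ (by linarith)).1 hx.le
      · exact exists_eventually_abs_le_of_eq_zero hΩ.continuous
          (contDiff_infty.1 hΩ.smooth 1).contDiffAt h0 (hΩ.fderiv_ne_zero h0) (hg p hp)
          fun y hy => hzero y (hΩ.mem_frontier_of_eq_zero hy)
  obtain ⟨K, hK⟩ := key
  exact ⟨K, fun x hx => hK x (subset_closure hx) (hΩ.mem_iff.1 hx)⟩

lemma deriv_smoothTransition_eq_zero {s : ℝ} (hs : s ∉ Icc (0 : ℝ) 1) :
    deriv Real.smoothTransition s = 0 := by
  have : s < 0 ∨ 1 < s := by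
    by_contra! h
    exact hs h
  rcases this with h | h
  · rw [(show Real.smoothTransition =ᶠ[𝓝 s] fun _ => 0 by
      filter_upwards [Iio_mem_nhds h] with y hy
      exact Real.smoothTransition.zero_of_nonpos (le_of_lt hy)).deriv_eq]
    simp
  · rw [(show Real.smoothTransition =ᶠ[𝓝 s] fun _ => 1 by
      filter_upwards [Ioi_mem_nhds h] with y hy
      exact Real.smoothTransition.one_of_one_le (le_of_lt hy)).deriv_eq]
    simp

lemma exists_abs_mul_deriv_smoothTransition_le :
    ∃ K, ∀ s : ℝ, |s * deriv Real.smoothTransition (s - 1)| ≤ K := by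
  have hc : Continuous (deriv Real.smoothTransition) :=
    (Real.smoothTransition.contDiff (n := 1)).continuous_deriv (by norm_num)
  have hcomp : HasCompactSupport fun s : ℝ => s * deriv Real.smoothTransition (s - 1) := by
    refine HasCompactSupport.intro (isCompact_Icc (a := (1 : ℝ)) (b := 2)) fun s hs => ?_
    rw [deriv_smoothTransition_eq_zero, mul_zero]
    rintro ⟨h0, h1⟩
    exact hs ⟨by linarith, by linarith⟩
  obtain ⟨K, hK⟩ := hcomp.exists_bound_of_continuous (by fun_prop)
  exact ⟨K, fun s => by simpa using hK s⟩

lemma integral_pd_eq_zero {F : Pt n → ℝ} (hF : ContDiff ℝ 1 F) (hF' : HasCompactSupport F)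
    (i : Fin n) : ∫ x, pd i F x = 0 := by
  have h := integral_mul_fderiv_eq_neg_fderiv_mul_of_integrable (μ := (volume : Measure (Pt n)))
    (f := fun _ => (1 : ℝ)) (g := F) (v := EuclideanSpace.single i 1)
    (by simp) ?_ ?_ (by fun_prop)
    (fun x _ => hF.differentiable (by norm_num) x)
  · simpa [pd] using h
  · have : Continuous fun x => fderiv ℝ F x (EuclideanSpace.single i 1) :=
      (hF.continuous_fderiv (by norm_num)).clm_apply continuous_const
    simpa using this.integrable_of_hasCompactSupport (hF'.fderiv_apply (𝕜 := ℝ) _)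
  · simpa using hF.continuous.integrable_of_hasCompactSupport hF'

/-- The cutoff function that vanishes where `ρ ≥ -ε` and equals `1` where `ρ ≤ -2 ε`. -/
noncomputable def cutoff (ρ : Pt n → ℝ) (ε : ℝ) (x : Pt n) : ℝ :=
  Real.smoothTransition (-ρ x / ε - 1)

lemma contDiff_cutoff (hρ : ContDiff ℝ ∞ ρ) (ε : ℝ) : ContDiff ℝ 1 (cutoff ρ ε) := by
  have h : ContDiff ℝ 1 ρ := contDiff_infty.1 hρ 1
  exact Real.smoothTransition.contDiff.comp ((h.neg.div_const ε).sub contDiff_const)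

lemma cutoff_eq_zero {ε : ℝ} (hε : 0 < ε) {x : Pt n} (hx : -ε ≤ ρ x) : cutoff ρ ε x = 0 := by
  refine Real.smoothTransition.zero_of_nonpos ?_
  rw [sub_nonpos, div_le_one hε]
  linarith

lemma pd_cutoff (hρ : ContDiff ℝ ∞ ρ) (ε : ℝ) (x : Pt n) (i : Fin n) :
    pd i (cutoff ρ ε) x
      = -(ε⁻¹ * deriv Real.smoothTransition (-ρ x / ε - 1) * pd i ρ x) := by
  have h1 : HasFDerivAt ρ (fderiv ℝ ρ x) x :=
    (hρ.differentiable (by simp) x).hasFDerivAt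
  have h2 : HasDerivAt Real.smoothTransition
      (deriv Real.smoothTransition (-ρ x / ε - 1)) (-ρ x / ε - 1) :=
    ((Real.smoothTransition.contDiff (n := 1)).differentiable (by norm_num) _).hasDerivAt
  have h3 := h2.comp_hasFDerivAt x ((h1.neg.mul_const ε⁻¹).sub_const 1)
  have h4 : HasFDerivAt (cutoff ρ ε) _ x := h3
  simp only [pd, h4.fderiv]
  simp
  ring

/-- The divergence theorem for a field that is tangential on the boundary. The field is multiplied
by a cutoff in the boundary layer `-2 ε < ρ < -ε`; the resulting term `ε⁻¹ θ' (W · ∇ρ)` is bounded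
uniformly in `ε`, because `W · ∇ρ = O(ρ)`, and tends to `0` pointwise. -/
theorem IsSmoothlyBoundedDomain.integral_div_eq_zero (hΩ : IsSmoothlyBoundedDomain Ω ρ)
    {W : Fin n → Pt n → ℝ} (hW : ∀ i, ∀ x ∈ closure Ω, ContDiffAt ℝ 1 (W i) x)
    (htan : ∀ x ∈ frontier Ω, ∑ i, W i x * pd i ρ x = 0) :
    ∫ x in Ω, ∑ i, pd i (W i) x = 0 := by
  set g : Pt n → ℝ := fun x => ∑ i, W i x * pd i ρ x with hg_def
  have hρ2 (x : Pt n) : ContDiffAt ℝ 2 ρ x := (contDiff_infty.1 hΩ.smooth 2).contDiffAt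
  have hg : ∀ x ∈ closure Ω, ContDiffAt ℝ 1 g x := fun x hx =>
    ContDiffAt.sum fun i _ => (hW i x hx).mul (contDiffAt_pd (hρ2 x) (by norm_num) i)
  obtain ⟨K, hK⟩ := hΩ.exists_abs_le hg htan
  obtain ⟨L, hL⟩ := exists_abs_mul_deriv_smoothTransition_le
  have hK0 : 0 ≤ K := by
    obtain ⟨x, hx⟩ := hΩ.isConnected.nonempty
    exact nonneg_of_mul_nonneg_left ((abs_nonneg _).trans (hK x hx))
      (by have := hΩ.mem_iff.1 hx; linarith)
  have hdiv : ∀ x ∈ closure Ω, ContinuousAt (fun x => ∑ i, pd i (W i) x) x := fun x hx =>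
    tendsto_finsetSum _ fun i _ =>
      (contDiffAt_pd (k := 0) (hW i x hx) (by norm_num) i).continuousAt
  -- the integrals of the divergence of the truncated fields vanish
  have hcut (ε : ℝ) (hε : 0 < ε) (i : Fin n) :
      ContDiff ℝ 1 (fun x => cutoff ρ ε x * W i x) ∧
        HasCompactSupport (fun x => cutoff ρ ε x * W i x) := by
    constructor
    · rw [contDiff_iff_contDiffAt]
      intro x
      by_cases hx : x ∈ closure Ω
      · exact (contDiff_cutoff hΩ.smooth ε).contDiffAt.mul (hW i x hx)
      · have h0 : -ε < ρ x := by
          have := not_lt.1 fun h => hx (subset_closure (hΩ.mem_iff.2 h))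
          linarith
        refine (contDiffAt_const (c := (0 : ℝ))).congr_of_eventuallyEq ?_
        filter_upwards [continuousAt_const.eventually_lt hΩ.continuous.continuousAt h0] with y hy
        rw [cutoff_eq_zero hε hy.le, zero_mul]
    · refine HasCompactSupport.intro hΩ.isCompact_closure fun x hx => ?_
      have := not_lt.1 fun h => hx (subset_closure (hΩ.mem_iff.2 h))
      rw [cutoff_eq_zero hε (by linarith), zero_mul]
  have hzero (ε : ℝ) (hε : 0 < ε) :
      ∫ x in Ω, (cutoff ρ ε x * ∑ i, pd i (W i) x
        - ε⁻¹ * deriv Real.smoothTransition (-ρ x / ε - 1) * g x) = 0 := by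
    have h1 : ∀ x ∈ Ω, cutoff ρ ε x * ∑ i, pd i (W i) x
        - ε⁻¹ * deriv Real.smoothTransition (-ρ x / ε - 1) * g x
        = ∑ i, pd i (fun y => cutoff ρ ε y * W i y) x := by
      intro x hx
      simp only [hg_def, Finset.mul_sum, ← Finset.sum_sub_distrib]
      refine Finset.sum_congr rfl fun i _ => ?_
      rw [pd_mul ((contDiff_cutoff hΩ.smooth ε).differentiable (by norm_num) x)
        ((hW i x (subset_closure hx)).differentiableAt (by norm_num)), pd_cutoff hΩ.smooth]
      ring
    have h2 : ∀ x ∉ Ω, ∑ i, pd i (fun y => cutoff ρ ε y * W i y) x = 0 := by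
      intro x hx
      refine Finset.sum_eq_zero fun i _ => ?_
      have h0 : -ε < ρ x := by
        have := not_lt.1 fun h => hx (hΩ.mem_iff.2 h)
        linarith
      rw [pd_congr (h := fun _ => 0) _ i, pd_const]
      filter_upwards [continuousAt_const.eventually_lt hΩ.continuous.continuousAt h0] with y hy
      rw [cutoff_eq_zero hε hy.le, zero_mul]
    rw [setIntegral_congr_fun hΩ.isOpen.measurableSet h1,
      setIntegral_eq_integral_of_forall_compl_eq_zero h2, integral_finsetSum]
    · exact Finset.sum_eq_zero fun i _ => integral_pd_eq_zero (hcut ε hε i).1 (hcut ε hε i).2 i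
    · intro i _
      have hc : Continuous (pd i fun y => cutoff ρ ε y * W i y) :=
        ((hcut ε hε i).1.continuous_fderiv (by norm_num)).clm_apply continuous_const
      exact hc.integrable_of_hasCompactSupport ((hcut ε hε i).2.fderiv_apply (𝕜 := ℝ) _)
  have hlim : Tendsto (fun k : ℕ => ∫ x in Ω, (cutoff ρ (1 / (k + 1)) x * ∑ i, pd i (W i) x
      - (1 / (k + 1) : ℝ)⁻¹ * deriv Real.smoothTransition (-ρ x / (1 / (k + 1)) - 1) * g x))
      atTop (𝓝 (∫ x in Ω, ∑ i, pd i (W i) x)) := by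
    refine tendsto_integral_of_dominated_convergence
      (fun x => |∑ i, pd i (W i) x| + L * K) ?_ ?_ ?_ ?_
    · intro k
      refine ContinuousOn.aestronglyMeasurable (fun x hx => ContinuousAt.continuousWithinAt ?_)
        hΩ.isOpen.measurableSet
      have hx' := subset_closure hx
      have h1 := (contDiff_cutoff hΩ.smooth (1 / (k + 1))).continuous.continuousAt (x := x)
      have h2 : Continuous (deriv Real.smoothTransition) :=
        (Real.smoothTransition.contDiff (n := 1)).continuous_deriv (by norm_num)
      have h3 := hΩ.continuous
      have h4 : Continuous fun x => (1 / (k + 1) : ℝ)⁻¹ *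
        deriv Real.smoothTransition (-ρ x / (1 / (k + 1)) - 1) := by fun_prop
      exact (h1.mul (hdiv x hx')).sub (h4.continuousAt.mul (hg x hx').continuousAt)
    · exact (hΩ.integrableOn fun x hx => (hdiv x hx).abs).add
        (hΩ.integrableOn fun x _ => continuousAt_const)
    · intro k
      refine (ae_restrict_mem hΩ.isOpen.measurableSet).mono fun x hx => ?_
      have hε : (0 : ℝ) < 1 / (k + 1) := by positivity
      set ε : ℝ := 1 / (k + 1)
      have hρx := hΩ.mem_iff.1 hx
      rw [Real.norm_eq_abs]
      refine (abs_sub _ _).trans (add_le_add ?_ ?_)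
      · rw [abs_mul]
        refine mul_le_of_le_one_left (abs_nonneg _) ?_
        rw [cutoff, abs_of_nonneg (Real.smoothTransition.nonneg _)]
        exact Real.smoothTransition.le_one _
      · calc |ε⁻¹ * deriv Real.smoothTransition (-ρ x / ε - 1) * g x|
            = ε⁻¹ * |deriv Real.smoothTransition (-ρ x / ε - 1)| * |g x| := by
              rw [abs_mul, abs_mul, abs_of_pos (inv_pos.2 hε)]
          _ ≤ ε⁻¹ * |deriv Real.smoothTransition (-ρ x / ε - 1)| * (K * -ρ x) := by
              gcongr
              exact hK x hx
          _ = |-ρ x / ε * deriv Real.smoothTransition (-ρ x / ε - 1)| * K := by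
              rw [abs_mul, abs_of_pos (div_pos (neg_pos.2 hρx) hε)]
              ring
          _ ≤ L * K := by
              gcongr
              exact hL _
    · refine (ae_restrict_mem hΩ.isOpen.measurableSet).mono fun x hx => ?_
      have hρx := hΩ.mem_iff.1 hx
      have hev : ∀ᶠ k : ℕ in atTop, 2 < -ρ x / (1 / (k + 1)) := by
        have h1 : Tendsto (fun k : ℕ => -ρ x * ((k : ℝ) + 1)) atTop atTop :=
          (tendsto_atTop_add_const_right _ _ tendsto_natCast_atTop_atTop).const_mul_atTop
            (neg_pos.2 hρx)
        filter_upwards [h1.eventually_gt_atTop 2] with k hk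
        rwa [one_div, div_inv_eq_mul]
      refine tendsto_const_nhds.congr' ?_
      filter_upwards [hev] with k hk
      rw [deriv_smoothTransition_eq_zero fun h => by linarith [h.2], cutoff,
        Real.smoothTransition.one_of_one_le (by linarith)]
      ring
  refine tendsto_nhds_unique hlim ?_
  simp_rw [fun k : ℕ => hzero (1 / (k + 1)) (by positivity)]
  exact tendsto_const_nhds

/-! ### Differentiation of integrals over the domain -/

/-- `h` is a family `s ↦ h s` of functions that is jointly `C¹` near `{t₀} × closure Ω`. Both the
variations `s ↦ u + s η` and the time evolution of a density are such families. -/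
def IsC1FamilyAt (Ω : Set (Pt n)) (h : ℝ → Pt n → ℝ) (t₀ : ℝ) : Prop :=
  ∀ x ∈ closure Ω, ContDiffAt ℝ 1 (fun p : ℝ × Pt n => h p.1 p.2) (t₀, x)

namespace IsC1FamilyAt

variable {h : ℝ → Pt n → ℝ} {t₀ : ℝ}

lemma hasDerivAt_of_contDiffAt {s : ℝ} {x : Pt n}
    (hh : ContDiffAt ℝ 1 (fun p : ℝ × Pt n => h p.1 p.2) (s, x)) :
    HasDerivAt (fun r => h r x) (fderiv ℝ (fun p : ℝ × Pt n => h p.1 p.2) (s, x) (1, 0)) s := by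
  have h1 : HasDerivAt (fun r : ℝ => (r, x)) ((1 : ℝ), (0 : Pt n)) s :=
    (hasDerivAt_id s).prodMk (hasDerivAt_const s x)
  exact (hh.differentiableAt (by norm_num)).hasFDerivAt.comp_hasDerivAt s h1

lemma hasDerivAt (hh : IsC1FamilyAt Ω h t₀) {x : Pt n} (hx : x ∈ closure Ω) :
    HasDerivAt (fun s => h s x) (deriv (fun s => h s x) t₀) t₀ :=
  (hasDerivAt_of_contDiffAt (hh x hx)).differentiableAt.hasDerivAt

lemma continuousAt_deriv (hh : IsC1FamilyAt Ω h t₀) {x : Pt n} (hx : x ∈ closure Ω) :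
    ContinuousAt (fun x => deriv (fun s => h s x) t₀) x := by
  have h1 : ContinuousAt (fun y => fderiv ℝ (fun p : ℝ × Pt n => h p.1 p.2) (t₀, y) (1, 0)) x := by
    have h2 := ((hh x hx).fderiv_right (m := 0) (by norm_num)).continuousAt
    have h3 : ContinuousAt (fun y : Pt n => (t₀, y)) x := by fun_prop
    exact (ContinuousAt.comp (f := fun y : Pt n => (t₀, y)) h2 h3).clm_apply continuousAt_const
  refine h1.congr ?_
  have h4 : ContinuousAt (fun y : Pt n => (t₀, y)) x := by fun_prop
  filter_upwards [h4.eventually ((hh x hx).eventually (by simp))] with y hy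
  exact (hasDerivAt_of_contDiffAt hy).deriv.symm

lemma hasDerivAt_integral (hΩ : IsSmoothlyBoundedDomain Ω ρ) (hh : IsC1FamilyAt Ω h t₀) :
    HasDerivAt (fun s => ∫ x in Ω, h s x) (∫ x in Ω, deriv (fun s => h s x) t₀) t₀ := by
  set f' : ℝ × Pt n → ℝ := fun p => fderiv ℝ (fun p : ℝ × Pt n => h p.1 p.2) p (1, 0)
  have hev : ∀ᶠ s in 𝓝 t₀, ∀ x ∈ closure Ω,
      ContDiffAt ℝ 1 (fun p : ℝ × Pt n => h p.1 p.2) (s, x) :=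
    hΩ.isCompact_closure.eventually_forall_of_forall_eventually fun x hx =>
      (hh x hx).eventually (by simp)
  obtain ⟨δ, hδ, hball⟩ := Metric.nhds_basis_closedBall.eventually_iff.1 hev
  have hK : IsCompact (Metric.closedBall t₀ δ ×ˢ closure Ω) :=
    (isCompact_closedBall t₀ δ).prod hΩ.isCompact_closure
  obtain ⟨B, hB⟩ := hK.exists_bound_of_continuousOn (f := f') fun p hp =>
    ((((hball hp.1 p.2 hp.2).fderiv_right (m := 0) (by norm_num)).continuousAt).clm_apply
      continuousAt_const).continuousWithinAt
  have hcont (s : ℝ) (hs : s ∈ Metric.closedBall t₀ δ) (x : Pt n) (hx : x ∈ closure Ω) :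
      ContinuousAt (h s) x := by
    have h3 : ContinuousAt (fun y : Pt n => (s, y)) x := by fun_prop
    exact ContinuousAt.comp (f := fun y : Pt n => (s, y)) (hball hs x hx).continuousAt h3
  have hnhds := Metric.closedBall_mem_nhds t₀ hδ
  refine (hasDerivAt_integral_of_dominated_loc_of_deriv_le (F := h)
    (F' := fun s x => deriv (fun s => h s x) s) (bound := fun _ => B) hnhds
    ?_ ?_ ?_ ?_ ?_ ?_).2
  · filter_upwards [hnhds] with s hs
    exact (hΩ.integrableOn (hcont s hs)).aestronglyMeasurable
  · exact hΩ.integrableOn (hcont t₀ (Metric.mem_closedBall_self hδ.le))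
  · exact (hΩ.integrableOn fun x hx => hh.continuousAt_deriv hx).aestronglyMeasurable
  · refine (ae_restrict_mem hΩ.isOpen.measurableSet).mono fun x hx s hs => ?_
    have hx' := subset_closure hx
    rw [(hasDerivAt_of_contDiffAt (hball hs x hx')).deriv]
    exact hB (s, x) ⟨hs, hx'⟩
  · exact hΩ.integrableOn fun x _ => continuousAt_const
  · refine (ae_restrict_mem hΩ.isOpen.measurableSet).mono fun x hx s hs => ?_
    exact (hasDerivAt_of_contDiffAt (hball hs x (subset_closure hx))).differentiableAt.hasDerivAt

/-- The observable `∫ h φ` along a family `h`. -/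
lemma hasDerivAt_linearObs (hΩ : IsSmoothlyBoundedDomain Ω ρ) (hh : IsC1FamilyAt Ω h t₀)
    {φ : Pt n → ℝ} (hφ : ∀ x ∈ closure Ω, ContDiffAt ℝ 1 φ x) :
    HasDerivAt (fun s => linearObs Ω φ (h s))
      (∫ x in Ω, deriv (fun s => h s x) t₀ * φ x) t₀ := by
  have hhφ : IsC1FamilyAt Ω (fun s x => h s x * φ x) t₀ := fun x hx =>
    (hh x hx).mul ((hφ x hx).comp (t₀, x) contDiffAt_snd)
  refine (hhφ.hasDerivAt_integral hΩ).congr_deriv ?_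
  refine setIntegral_congr_fun hΩ.isOpen.measurableSet fun x hx => ?_
  exact ((hh.hasDerivAt (subset_closure hx)).mul_const (φ x)).deriv

lemma hasDerivAt_totalNumber (hΩ : IsSmoothlyBoundedDomain Ω ρ) (hh : IsC1FamilyAt Ω h t₀) :
    HasDerivAt (fun s => totalNumber Ω (h s)) (∫ x in Ω, deriv (fun s => h s x) t₀) t₀ :=
  hh.hasDerivAt_integral hΩ

lemma hasDerivAt_entropy (hΩ : IsSmoothlyBoundedDomain Ω ρ) (hh : IsC1FamilyAt Ω h t₀)
    (hpos : ∀ x ∈ closure Ω, 0 < h t₀ x) :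
    HasDerivAt (fun s => entropy Ω (h s))
      (-∫ x in Ω, deriv (fun s => h s x) t₀ * (Real.log (h t₀ x) + 1)) t₀ := by
  have hhl : IsC1FamilyAt Ω (fun s x => h s x * Real.log (h s x)) t₀ := fun x hx =>
    (hh x hx).mul ((hh x hx).log (hpos x hx).ne')
  refine (hhl.hasDerivAt_integral hΩ).neg.congr_deriv (congrArg Neg.neg ?_)
  refine setIntegral_congr_fun hΩ.isOpen.measurableSet fun x hx => ?_
  have h0 := hpos x (subset_closure hx)
  have h1 := hh.hasDerivAt (subset_closure hx)
  refine (h1.mul (h1.log h0.ne')).deriv.trans ?_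
  field_simp

lemma hasDerivAt_constrainedEntropy (hΩ : IsSmoothlyBoundedDomain Ω ρ)
    (hh : IsC1FamilyAt Ω h t₀) (hpos : ∀ x ∈ closure Ω, 0 < h t₀ x) {m : ℕ}
    {H : Pt n → ℝ} (hH : CkUpTo ⊤ Ω H) {C : Fin m → Pt n → ℝ} (hC : ∀ k, CkUpTo ⊤ Ω (C k))
    (α b : ℝ) (μ : Fin m → ℝ) :
    HasDerivAt (fun s => constrainedEntropy Ω H C α b μ (h s))
      (∫ x in Ω, deriv (fun s => h s x) t₀ *
        (-Real.log (h t₀ x) - 1 - α - b * H x - ∑ k, μ k * C k x)) t₀ := by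
  have hH1 : ∀ x ∈ closure Ω, ContDiffAt ℝ 1 H x := fun x hx =>
    (hH.contDiffAt hx).of_le (by exact_mod_cast le_top)
  have hC1 : ∀ k, ∀ x ∈ closure Ω, ContDiffAt ℝ 1 (C k) x := fun k x hx =>
    ((hC k).contDiffAt hx).of_le (by exact_mod_cast le_top)
  have hS := hh.hasDerivAt_entropy hΩ hpos
  have hN := (hh.hasDerivAt_totalNumber hΩ).const_mul α
  have hE := (hh.hasDerivAt_linearObs hΩ hH1).const_mul b
  have hCs := HasDerivAt.fun_sum (u := Finset.univ) fun k _ =>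
    (hh.hasDerivAt_linearObs hΩ (hC1 k)).const_mul (μ k)
  refine (((hS.sub hN).sub hE).sub hCs).congr_deriv ?_
  have hd : ∀ x ∈ closure Ω, ContinuousAt (fun x => deriv (fun s => h s x) t₀) x :=
    fun x hx => hh.continuousAt_deriv hx
  have hl : ∀ x ∈ closure Ω, ContinuousAt (fun x => Real.log (h t₀ x)) x := fun x hx =>
    (ContinuousAt.comp (f := fun y : Pt n => (t₀, y)) (hh x hx).continuousAt
      (by fun_prop)).log (hpos x hx).ne'
  have i1 : IntegrableOn (fun x => deriv (fun s => h s x) t₀ * (Real.log (h t₀ x) + 1)) Ω :=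
    hΩ.integrableOn fun x hx => (hd x hx).mul ((hl x hx).add continuousAt_const)
  have i2 : IntegrableOn (fun x => deriv (fun s => h s x) t₀) Ω := hΩ.integrableOn hd
  have i3 : IntegrableOn (fun x => deriv (fun s => h s x) t₀ * H x) Ω :=
    hΩ.integrableOn fun x hx => (hd x hx).mul (hH1 x hx).continuousAt
  have i4 : ∀ k, IntegrableOn (fun x => deriv (fun s => h s x) t₀ * C k x) Ω := fun k =>
    hΩ.integrableOn fun x hx => (hd x hx).mul (hC1 k x hx).continuousAt
  simp only [← integral_const_mul, ← integral_neg]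
  rw [← integral_finsetSum _ fun k _ => (i4 k).const_mul (μ k)]
  symm
  calc _ = ∫ x in Ω, (-(deriv (fun s => h s x) t₀ * (Real.log (h t₀ x) + 1))
          - α * deriv (fun s => h s x) t₀ - b * (deriv (fun s => h s x) t₀ * H x)
          - ∑ k, μ k * (deriv (fun s => h s x) t₀ * C k x)) := by
        refine integral_congr_ae (ae_of_all _ fun x => ?_)
        have : ∑ k, μ k * (deriv (fun s => h s x) t₀ * C k x)
            = deriv (fun s => h s x) t₀ * ∑ k, μ k * C k x := by
          rw [Finset.mul_sum]
          exact Finset.sum_congr rfl fun k _ => by ring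
        simp only [this]
        ring
    _ = _ := by
        rw [integral_sub, integral_sub, integral_sub]
        · exact i1.neg
        · exact i2.const_mul α
        · exact i1.neg.sub (i2.const_mul α)
        · exact i3.const_mul b
        · exact (i1.neg.sub (i2.const_mul α)).sub (i3.const_mul b)
        · exact integrable_finsetSum _ fun k _ => (i4 k).const_mul (μ k)

end IsC1FamilyAt

/-! ### Functional derivatives -/

/-- Test functions that are smooth up to the boundary separate continuous functions on `Ω`. -/
lemma IsSmoothlyBoundedDomain.eqOn_of_integral_mul_eq (hΩ : IsSmoothlyBoundedDomain Ω ρ)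
    {g h : Pt n → ℝ} (hg : ∀ x ∈ closure Ω, ContinuousAt g x)
    (hh : ∀ x ∈ closure Ω, ContinuousAt h x)
    (heq : ∀ φ, CkUpTo ⊤ Ω φ → ∫ x in Ω, g x * φ x = ∫ x in Ω, h x * φ x) : EqOn g h Ω := by
  have hcg : ContinuousOn g Ω := fun x hx => (hg x (subset_closure hx)).continuousWithinAt
  have hch : ContinuousOn h Ω := fun x hx => (hh x (subset_closure hx)).continuousWithinAt
  have key := hΩ.isOpen.ae_eq_zero_of_integral_contDiff_smul_eq_zero (μ := volume)
    ((hcg.sub hch).locallyIntegrableOn hΩ.isOpen.measurableSet) fun φ hφ _ hφΩ => by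
      have h1 : ∀ x ∉ Ω, φ x • (g - h) x = 0 := fun x hx => by
        rw [image_eq_zero_of_notMem_tsupport fun h => hx (hφΩ h), zero_smul]
      rw [← setIntegral_eq_integral_of_forall_compl_eq_zero h1]
      have hφc := hφ.continuous
      have h2 : ∫ x in Ω, (g x * φ x - h x * φ x)
          = (∫ x in Ω, g x * φ x) - ∫ x in Ω, h x * φ x := integral_sub
        (hΩ.integrableOn fun x hx => (hg x hx).mul (hφc.continuousAt (x := x)))
        (hΩ.integrableOn fun x hx => (hh x hx).mul (hφc.continuousAt (x := x)))
      rw [heq φ (ckUpTo_of_contDiff hφ), sub_self] at h2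
      rw [← h2]
      refine integral_congr_ae (ae_of_all _ fun x => ?_)
      simp only [Pi.sub_apply, smul_eq_mul]
      ring
  refine Measure.eqOn_open_of_ae_eq (μ := volume) ?_ hΩ.isOpen hcg hch
  rw [EventuallyEq, ae_restrict_iff' hΩ.isOpen.measurableSet]
  exact key.mono fun x hx hxΩ => sub_eq_zero.1 (hx hxΩ)

section FunctionalDeriv

variable {F G : (Pt n → ℝ) → ℝ} {u g h : Pt n → ℝ}

lemma HasFunctionalDeriv.eqOn (hΩ : IsSmoothlyBoundedDomain Ω ρ)
    (hg : HasFunctionalDeriv Ω F u g) (hh : HasFunctionalDeriv Ω F u h) : EqOn g h Ω :=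
  hΩ.eqOn_of_integral_mul_eq (fun _ hx => (hg.1.contDiffAt hx).continuousAt)
    (fun _ hx => (hh.1.contDiffAt hx).continuousAt) fun φ hφ => (hg.2 φ hφ).unique (hh.2 φ hφ)

lemma HasFunctionalDeriv.differentiableAt (hg : HasFunctionalDeriv Ω F u g) :
    FunctionalDifferentiableAt Ω F u := ⟨g, hg⟩

lemma FunctionalDifferentiableAt.hasFunctionalDeriv (hF : FunctionalDifferentiableAt Ω F u) :
    HasFunctionalDeriv Ω F u (functionalDeriv Ω F u) := by
  rw [functionalDeriv, dif_pos hF]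
  exact Classical.choose_spec hF

lemma HasFunctionalDeriv.pd_functionalDeriv (hΩ : IsSmoothlyBoundedDomain Ω ρ)
    (hg : HasFunctionalDeriv Ω F u g) {x : Pt n} (hx : x ∈ Ω) (i : Fin n) :
    pd i (functionalDeriv Ω F u) x = pd i g x :=
  pd_congr_of_eqOn hΩ.isOpen (hg.differentiableAt.hasFunctionalDeriv.eqOn hΩ hg) hx i

lemma poissonBracket_eq (hΩ : IsSmoothlyBoundedDomain Ω ρ)
    (hg : HasFunctionalDeriv Ω F u g) (hh : HasFunctionalDeriv Ω G u h)
    (𝒥 : Pt n → Matrix (Fin n) (Fin n) ℝ) :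
    poissonBracket Ω 𝒥 F G u
      = ∫ x in Ω, u x * ∑ i, ∑ j, pd i g x * 𝒥 x i j * pd j h x :=
  setIntegral_congr_fun hΩ.isOpen.measurableSet fun x hx => by
    simp only [hg.pd_functionalDeriv hΩ hx, hh.pd_functionalDeriv hΩ hx]

lemma dissipativeBracket_eq (hΩ : IsSmoothlyBoundedDomain Ω ρ)
    (hg : HasFunctionalDeriv Ω F u g) (hh : HasFunctionalDeriv Ω G u h)
    (𝒥 : Pt n → Matrix (Fin n) (Fin n) ℝ) (D : ℝ) :
    dissipativeBracket Ω 𝒥 D F G u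
      = D / 2 * ∫ x in Ω, u x * ∑ i, ∑ j, pd i g x * dissTensor 𝒥 x i j * pd j h x :=
  congrArg (D / 2 * ·) <| setIntegral_congr_fun hΩ.isOpen.measurableSet fun x hx => by
    simp only [hg.pd_functionalDeriv hΩ hx, hh.pd_functionalDeriv hΩ hx]

lemma isC1FamilyAt_variation (hu : CkUpTo 1 Ω u) {η : Pt n → ℝ} (hη : CkUpTo ⊤ Ω η) :
    IsC1FamilyAt Ω (fun ε x => u x + ε * η x) 0 := fun x hx =>
  ((hu.contDiffAt hx).comp ((0 : ℝ), x) contDiffAt_snd).add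
    (contDiffAt_fst.mul
      (((hη.contDiffAt hx).of_le (by exact_mod_cast le_top)).comp ((0 : ℝ), x) contDiffAt_snd))

lemma deriv_variation (η : Pt n → ℝ) (x : Pt n) :
    deriv (fun ε : ℝ => u x + ε * η x) 0 = η x := by
  simp

lemma hasFunctionalDeriv_linearObs (hΩ : IsSmoothlyBoundedDomain Ω ρ) (hu : IsDensity Ω u)
    {φ : Pt n → ℝ} (hφ : CkUpTo ⊤ Ω φ) : HasFunctionalDeriv Ω (linearObs Ω φ) u φ := by
  have hφ1 : ∀ x ∈ closure Ω, ContDiffAt ℝ 1 φ x := fun x hx =>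
    (hφ.contDiffAt hx).of_le (by exact_mod_cast le_top)
  refine ⟨ckUpTo_of_contDiffAt hφ1, fun η hη => ?_⟩
  refine ((isC1FamilyAt_variation hu.1 hη).hasDerivAt_linearObs hΩ hφ1).congr_deriv ?_
  simp only [deriv_variation, mul_comm]

lemma hasFunctionalDeriv_totalNumber (hΩ : IsSmoothlyBoundedDomain Ω ρ) (hu : IsDensity Ω u) :
    HasFunctionalDeriv Ω (totalNumber Ω) u (fun _ => 1) := by
  have h : totalNumber Ω = linearObs Ω (fun _ => 1) := by
    ext u
    simp [totalNumber, linearObs]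
  rw [h]
  exact hasFunctionalDeriv_linearObs hΩ hu (ckUpTo_of_contDiff contDiff_const)

lemma hasFunctionalDeriv_constrainedEntropy (hΩ : IsSmoothlyBoundedDomain Ω ρ)
    (hu : IsDensity Ω u) {m : ℕ} {H : Pt n → ℝ} (hH : CkUpTo ⊤ Ω H) {C : Fin m → Pt n → ℝ}
    (hC : ∀ k, CkUpTo ⊤ Ω (C k)) (α b : ℝ) (μ : Fin m → ℝ) :
    HasFunctionalDeriv Ω (constrainedEntropy Ω H C α b μ) u
      (fun x => -Real.log (u x) - 1 - α - b * H x - ∑ k, μ k * C k x) := by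
  refine ⟨ckUpTo_of_contDiffAt fun x hx => ?_, fun η hη => ?_⟩
  · have hH1 : ContDiffAt ℝ 1 H x := (hH.contDiffAt hx).of_le (by exact_mod_cast le_top)
    have hC1 (k) : ContDiffAt ℝ 1 (C k) x :=
      ((hC k).contDiffAt hx).of_le (by exact_mod_cast le_top)
    have hl : ContDiffAt ℝ 1 (fun x => Real.log (u x)) x :=
      (hu.1.contDiffAt hx).log (hu.2 x hx).ne'
    exact (((hl.neg.sub contDiffAt_const).sub contDiffAt_const).sub
      (contDiffAt_const.mul hH1)).sub (ContDiffAt.sum fun k _ => contDiffAt_const.mul (hC1 k))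
  · have h := (isC1FamilyAt_variation hu.1 hη).hasDerivAt_constrainedEntropy hΩ
      (by simpa using hu.2) hH hC α b μ
    refine h.congr_deriv ?_
    simp only [deriv_variation, zero_mul, add_zero, mul_comm (η _)]

end FunctionalDeriv

/-! ### Algebra of the Poisson and dissipative tensors -/

section Algebra

variable {𝒥 : Pt n → Matrix (Fin n) (Fin n) ℝ} {H : Pt n → ℝ} {x : Pt n}

lemma IsPoissonOperator.sum_sum_mul_self (h𝒥 : IsPoissonOperator Ω 𝒥) (hx : x ∈ Ω)
    (a : Fin n → ℝ) : ∑ i, ∑ j, a i * 𝒥 x i j * a j = 0 := by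
  have h : ∑ i, ∑ j, a i * 𝒥 x i j * a j = -∑ i, ∑ j, a i * 𝒥 x i j * a j := by
    conv_lhs => rw [Finset.sum_comm]
    simp only [← Finset.sum_neg_distrib]
    refine Finset.sum_congr rfl fun i _ => Finset.sum_congr rfl fun j _ => ?_
    rw [h𝒥.antisymm x hx j i]
    ring
  linarith

lemma IsPoissonOperator.sum_sum_mul_eq_neg (h𝒥 : IsPoissonOperator Ω 𝒥) (hx : x ∈ Ω)
    (a b : Fin n → ℝ) :
    ∑ i, ∑ j, a i * 𝒥 x i j * b j = -∑ i, b i * ∑ j, 𝒥 x i j * a j := by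
  rw [Finset.sum_comm]
  simp only [Finset.mul_sum, ← Finset.sum_neg_distrib]
  refine Finset.sum_congr rfl fun i _ => Finset.sum_congr rfl fun j _ => ?_
  rw [h𝒥.antisymm x hx j i]
  ring

/-- The dissipative tensor is the Gram matrix `𝒥ᵀ 𝒥` of the antisymmetric matrix `𝒥`. -/
lemma IsPoissonOperator.sum_dissTensor (h𝒥 : IsPoissonOperator Ω 𝒥) (hx : x ∈ Ω)
    (a b : Fin n → ℝ) :
    ∑ i, ∑ j, a i * dissTensor 𝒥 x i j * b j
      = ∑ k, (∑ j, 𝒥 x k j * a j) * ∑ j, 𝒥 x k j * b j := by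
  have h : ∀ i j, a i * dissTensor 𝒥 x i j * b j
      = ∑ k, (𝒥 x k i * a i) * (𝒥 x k j * b j) := fun i j => by
    rw [dissTensor, Finset.mul_sum, Finset.sum_mul]
    refine Finset.sum_congr rfl fun k _ => ?_
    rw [h𝒥.antisymm x hx i k, h𝒥.antisymm x hx j k]
    ring
  simp only [h, Finset.sum_mul_sum]
  rw [Finset.sum_congr rfl fun i _ => Finset.sum_comm, Finset.sum_comm]

lemma sum_mul_fpVelocity (a : Fin n → ℝ) (D b : ℝ) (u : Pt n → ℝ) :
    ∑ i, a i * fpVelocity 𝒥 H D b u x i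
      = ∑ i, ∑ j, a i * 𝒥 x i j * pd j H x
        - D / 2 * ∑ i, ∑ j, a i * dissTensor 𝒥 x i j *
          pd j (fun y => Real.log (u y) + b * H y) x := by
  simp only [fpVelocity, mul_sub, Finset.sum_sub_distrib, Finset.mul_sum]
  congr 1
  · exact Finset.sum_congr rfl fun i _ => Finset.sum_congr rfl fun j _ => by ring
  · exact Finset.sum_congr rfl fun i _ => Finset.sum_congr rfl fun j _ => by ring

lemma IsSmoothlyBoundedDomain.sum_mul_pd_eq_zero (hΩ : IsSmoothlyBoundedDomain Ω ρ)
    (hx : x ∈ frontier Ω) {v : Pt n} (hv : inner ℝ v (outwardNormal ρ x) = 0) :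
    ∑ i, v i * pd i ρ x = 0 := by
  have h0 : ρ x = 0 := by
    rw [hΩ.isOpen.frontier_eq] at hx
    exact le_antisymm (hΩ.nonpos_of_mem_closure hx.1) (not_lt.1 fun h => hx.2 (hΩ.mem_iff.2 h))
  have hg : ‖gradient ρ x‖⁻¹ ≠ 0 := inv_ne_zero (norm_ne_zero_iff.2 (hΩ.regular x h0))
  rw [outwardNormal, inner_smul_right, mul_eq_zero, or_iff_right hg, real_inner_comm,
    inner_gradient_left] at hv
  rw [← hv]
  have hsum : v = ∑ i, v i • EuclideanSpace.single i (1 : ℝ) := by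
    ext k
    simp [Finset.sum_apply, Pi.single_apply]
  conv_rhs => rw [hsum]
  simp [pd]

end Algebra

/-! ### The Fokker–Planck operator in weak form -/

/-- A Poisson operator and a Hamiltonian on a smoothly bounded domain, with the coordinates spanning
the invariant measure. -/
structure IsInvariantSystem (Ω : Set (Pt n)) (ρ : Pt n → ℝ)
    (𝒥 : Pt n → Matrix (Fin n) (Fin n) ℝ) (H : Pt n → ℝ) : Prop where
  domain : IsSmoothlyBoundedDomain Ω ρ
  poisson : IsPoissonOperator Ω 𝒥
  divFree : IsDivFree Ω 𝒥
  hamiltonian : CkUpTo ⊤ Ω H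

/-- Positive densities, of class `C²` up to the boundary. -/
structure IsC2Density (Ω : Set (Pt n)) (u : Pt n → ℝ) : Prop where
  contDiffAt : ∀ x ∈ closure Ω, ContDiffAt ℝ 2 u x
  pos : ∀ x ∈ closure Ω, 0 < u x

namespace IsC2Density

variable {u : Pt n → ℝ} {x : Pt n}

lemma isDensity (hu : IsC2Density Ω u) : IsDensity Ω u :=
  ⟨ckUpTo_of_contDiffAt fun x hx => (hu.contDiffAt x hx).of_le (by norm_num), hu.pos⟩

lemma differentiableAt (hu : IsC2Density Ω u) (hx : x ∈ closure Ω) : DifferentiableAt ℝ u x :=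
  (hu.contDiffAt x hx).differentiableAt (by norm_num)

lemma continuousAt (hu : IsC2Density Ω u) (hx : x ∈ closure Ω) : ContinuousAt u x :=
  (hu.contDiffAt x hx).continuousAt

lemma continuousAt_pd (hu : IsC2Density Ω u) (hx : x ∈ closure Ω) (i : Fin n) :
    ContinuousAt (pd i u) x :=
  (contDiffAt_pd (k := 1) (hu.contDiffAt x hx) (by norm_num) i).continuousAt

end IsC2Density

namespace IsInvariantSystem

variable {𝒥 : Pt n → Matrix (Fin n) (Fin n) ℝ} {H : Pt n → ℝ} {u φ g : Pt n → ℝ} {x : Pt n}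
  {D b c : ℝ}

lemma contDiffAt_tensor (S : IsInvariantSystem Ω ρ 𝒥 H) (k : ℕ) (hx : x ∈ closure Ω)
    (i j : Fin n) : ContDiffAt ℝ k (fun y => 𝒥 y i j) x :=
  ((S.poisson.smooth i j).contDiffAt hx).of_le (by exact_mod_cast le_top)

lemma contDiffAt_hamiltonian (S : IsInvariantSystem Ω ρ 𝒥 H) (k : ℕ) (hx : x ∈ closure Ω) :
    ContDiffAt ℝ k H x :=
  (S.hamiltonian.contDiffAt hx).of_le (by exact_mod_cast le_top)

lemma contDiffAt_pd_hamiltonian (S : IsInvariantSystem Ω ρ 𝒥 H) (hx : x ∈ closure Ω)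
    (i : Fin n) : ContDiffAt ℝ 1 (pd i H) x :=
  contDiffAt_pd (S.contDiffAt_hamiltonian 2 hx) (by norm_num) i

lemma contDiffAt_dissTensor (S : IsInvariantSystem Ω ρ 𝒥 H) (hx : x ∈ closure Ω)
    (i j : Fin n) : ContDiffAt ℝ 1 (fun y => dissTensor 𝒥 y i j) x :=
  ContDiffAt.sum fun k _ => (S.contDiffAt_tensor 1 hx i k).mul (S.contDiffAt_tensor 1 hx j k)

lemma contDiffAt_freeEnergy (S : IsInvariantSystem Ω ρ 𝒥 H) (hu : IsC2Density Ω u) (b : ℝ)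
    (hx : x ∈ closure Ω) : ContDiffAt ℝ 2 (fun y => Real.log (u y) + b * H y) x :=
  ((hu.contDiffAt x hx).log (hu.pos x hx).ne').add
    (contDiffAt_const.mul (S.contDiffAt_hamiltonian 2 hx))

lemma contDiffAt_pd_freeEnergy (S : IsInvariantSystem Ω ρ 𝒥 H) (hu : IsC2Density Ω u) (b : ℝ)
    (hx : x ∈ closure Ω) (i : Fin n) :
    ContDiffAt ℝ 1 (pd i fun y => Real.log (u y) + b * H y) x :=
  contDiffAt_pd (S.contDiffAt_freeEnergy hu b hx) (by norm_num) i

lemma pd_freeEnergy (S : IsInvariantSystem Ω ρ 𝒥 H) (hu : IsC2Density Ω u) (b : ℝ)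
    (hx : x ∈ closure Ω) (i : Fin n) :
    pd i (fun y => Real.log (u y) + b * H y) x = (u x)⁻¹ * pd i u x + b * pd i H x := by
  have hu1 := hu.differentiableAt hx
  have hH1 := (S.contDiffAt_hamiltonian 1 hx).differentiableAt (by norm_num)
  have h0 := (hu.pos x hx).ne'
  rw [pd_add (hu1.log h0) (hH1.const_mul b), pd_log hu1 h0, pd_const_mul hH1]

lemma contDiffAt_velocity (S : IsInvariantSystem Ω ρ 𝒥 H) (hx : x ∈ closure Ω) (i : Fin n) :
    ContDiffAt ℝ 1 (fun y => velocity 𝒥 H y i) x := by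
  change ContDiffAt ℝ 1 (fun y => ∑ j, 𝒥 y i j * pd j H y) x
  exact ContDiffAt.sum fun j _ => (S.contDiffAt_tensor 1 hx i j).mul (S.contDiffAt_pd_hamiltonian hx j)

lemma contDiffAt_fpVelocity (S : IsInvariantSystem Ω ρ 𝒥 H) (hu : IsC2Density Ω u)
    (D b : ℝ) (hx : x ∈ closure Ω) (i : Fin n) :
    ContDiffAt ℝ 1 (fun y => fpVelocity 𝒥 H D b u y i) x :=
  (S.contDiffAt_velocity hx i).sub (contDiffAt_const.mul (ContDiffAt.sum fun j _ =>
    (S.contDiffAt_dissTensor hx i j).mul (S.contDiffAt_pd_freeEnergy hu b hx j)))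

/-- The right-hand side of the Fokker–Planck equation is the divergence of a `C¹` flux, hence
continuous up to the boundary. -/
lemma continuousAt_fpRHS (S : IsInvariantSystem Ω ρ 𝒥 H) (hu : IsC2Density Ω u) (D c : ℝ)
    (hx : x ∈ closure Ω) : ContinuousAt (fpRHS 𝒥 H D c u) x := by
  have hu1 : ContDiffAt ℝ 1 u x := (hu.contDiffAt x hx).of_le (by norm_num)
  refine tendsto_finsetSum _ fun i _ =>
    (contDiffAt_pd (k := 0) (l := 1) ?_ (by norm_num) i).continuousAt
  refine ((ContDiffAt.sum fun j _ => ?_).neg.add (contDiffAt_const.mul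
    (ContDiffAt.sum fun j _ => ?_))).add (contDiffAt_const.mul (ContDiffAt.sum fun k _ =>
      (S.contDiffAt_tensor 1 hx i k).mul (ContDiffAt.sum fun j _ => ?_)))
  · exact ((S.contDiffAt_tensor 1 hx i j).mul (S.contDiffAt_pd_hamiltonian hx j)).mul hu1
  · exact ((S.contDiffAt_dissTensor hx i j).mul (S.contDiffAt_pd_hamiltonian hx j)).mul hu1
  · exact contDiffAt_pd ((S.contDiffAt_tensor 2 hx j k).mul (hu.contDiffAt x hx)) (by norm_num) j

/-- The Fokker–Planck equation is the continuity equation of the velocity field `Z`. -/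
lemma fpRHS_eq (S : IsInvariantSystem Ω ρ 𝒥 H) (hu : IsC2Density Ω u) (hc : 2 * c = D * b)
    (hx : x ∈ Ω) :
    fpRHS 𝒥 H D c u x = -∑ i, pd i (fun y => u y * fpVelocity 𝒥 H D b u y i) x := by
  rw [fpRHS, ← Finset.sum_neg_distrib]
  refine Finset.sum_congr rfl fun i _ => ?_
  rw [← pd_neg]
  refine pd_congr_of_eqOn S.domain.isOpen (fun y hy => ?_) hx i
  have hy' := subset_closure hy
  have h0 := (hu.pos y hy').ne'
  -- by the invariance of the measure, `∂ⱼ (𝒥ʲᵏ u) = 𝒥ʲᵏ uⱼ`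
  have hdiv (k : Fin n) : ∑ j, pd j (fun z => 𝒥 z j k * u z) y = ∑ j, 𝒥 y j k * pd j u y := by
    have h (j : Fin n) : pd j (fun z => 𝒥 z j k * u z) y
        = 𝒥 y j k * pd j u y + u y * pd j (fun z => 𝒥 z j k) y :=
      pd_mul ((S.contDiffAt_tensor 1 hy' j k).differentiableAt (by norm_num))
        (hu.differentiableAt hy') j
    simp only [h, Finset.sum_add_distrib, ← Finset.mul_sum, S.divFree y hy k, mul_zero, add_zero]
  have hdiss : ∑ k, 𝒥 y i k * ∑ j, 𝒥 y j k * pd j u y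
      = ∑ j, dissTensor 𝒥 y i j * pd j u y := by
    simp only [dissTensor, Finset.mul_sum, Finset.sum_mul]
    rw [Finset.sum_comm]
    exact Finset.sum_congr rfl fun j _ => Finset.sum_congr rfl fun k _ => by ring
  have hfree : u y * ∑ j, dissTensor 𝒥 y i j * pd j (fun z => Real.log (u z) + b * H z) y
      = ∑ j, dissTensor 𝒥 y i j * pd j u y
        + b * ∑ j, dissTensor 𝒥 y i j * pd j H y * u y := by
    simp only [Finset.mul_sum, ← Finset.sum_add_distrib]
    refine Finset.sum_congr rfl fun j _ => ?_
    rw [S.pd_freeEnergy hu b hy']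
    field_simp
  simp only [hdiv, hdiss, fpVelocity, mul_sub]
  rw [mul_left_comm, hfree, ← Finset.sum_mul]
  linear_combination (∑ j, dissTensor 𝒥 y i j * pd j H y * u y) * hc / 2

/-- Integration by parts; the boundary term vanishes because `Z` is tangential. -/
lemma integral_fpRHS_mul (S : IsInvariantSystem Ω ρ 𝒥 H) (hu : IsC2Density Ω u)
    (hc : 2 * c = D * b)
    (hbc : ∀ x ∈ frontier Ω, inner ℝ (fpVelocity 𝒥 H D b u x) (outwardNormal ρ x) = 0)
    (hφ : ∀ x ∈ closure Ω, ContDiffAt ℝ 1 φ x) :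
    ∫ x in Ω, fpRHS 𝒥 H D c u x * φ x
      = ∫ x in Ω, u x * ∑ i, pd i φ x * fpVelocity 𝒥 H D b u x i := by
  have hflux (i : Fin n) (x : Pt n) (hx : x ∈ closure Ω) :
      ContDiffAt ℝ 1 (fun y => u y * fpVelocity 𝒥 H D b u y i) x :=
    ((hu.contDiffAt x hx).of_le (by norm_num)).mul (S.contDiffAt_fpVelocity hu D b hx i)
  have hdiv := S.domain.integral_div_eq_zero
    (W := fun i y => φ y * (u y * fpVelocity 𝒥 H D b u y i))
    (fun i x hx => (hφ x hx).mul (hflux i x hx)) fun x hx => by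
      have h := S.domain.sum_mul_pd_eq_zero hx (hbc x hx)
      calc _ = φ x * u x * ∑ i, fpVelocity 𝒥 H D b u x i * pd i ρ x := by
            rw [Finset.mul_sum]
            exact Finset.sum_congr rfl fun i _ => by ring
        _ = 0 := by rw [h, mul_zero]
  have hi1 : IntegrableOn (fun x => u x * ∑ i, pd i φ x * fpVelocity 𝒥 H D b u x i) Ω :=
    S.domain.integrableOn fun x hx => (hu.continuousAt hx).mul
      (tendsto_finsetSum _ fun i _ =>
        (contDiffAt_pd (k := 0) (hφ x hx) (by norm_num) i).continuousAt.mul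
          (S.contDiffAt_fpVelocity hu D b hx i).continuousAt)
  have hi2 : IntegrableOn (fun x => fpRHS 𝒥 H D c u x * φ x) Ω :=
    S.domain.integrableOn fun x hx => (S.continuousAt_fpRHS hu D c hx).mul (hφ x hx).continuousAt
  have hpt : ∀ x ∈ Ω, ∑ i, pd i (fun y => φ y * (u y * fpVelocity 𝒥 H D b u y i)) x
      = u x * ∑ i, pd i φ x * fpVelocity 𝒥 H D b u x i - fpRHS 𝒥 H D c u x * φ x := by
    intro x hx
    have hx' := subset_closure hx
    rw [S.fpRHS_eq hu hc hx, neg_mul, sub_neg_eq_add, Finset.sum_mul, Finset.mul_sum,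
      ← Finset.sum_add_distrib]
    refine Finset.sum_congr rfl fun i _ => ?_
    rw [pd_mul ((hφ x hx').differentiableAt (by norm_num))
      ((hflux i x hx').differentiableAt (by norm_num))]
    ring
  rw [setIntegral_congr_fun S.domain.isOpen.measurableSet hpt, integral_sub hi1 hi2] at hdiv
  linarith

variable {m : ℕ} {C : Fin m → Pt n → ℝ} {F : (Pt n → ℝ) → ℝ}

/-- The Casimir part of the functional derivative of `Σ` is invisible to both brackets. -/
lemma sum_mul_pd_constrainedEntropyDeriv (S : IsInvariantSystem Ω ρ 𝒥 H) (hu : IsC2Density Ω u)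
    (hC : ∀ k, CkUpTo ⊤ Ω (C k)) (hCas : ∀ k, IsMicroCasimir Ω 𝒥 (C k)) (α b : ℝ)
    (μ : Fin m → ℝ) (hx : x ∈ Ω) (i : Fin n) :
    ∑ j, 𝒥 x i j * pd j (fun y => -Real.log (u y) - 1 - α - b * H y - ∑ k, μ k * C k y) x
      = -∑ j, 𝒥 x i j * pd j (fun y => Real.log (u y) + b * H y) x := by
  have hx' := subset_closure hx
  have hC1 (k) : DifferentiableAt ℝ (C k) x :=
    ((hC k).contDiffAt hx').differentiableAt (by simp)
  have hw : DifferentiableAt ℝ (fun y => Real.log (u y) + b * H y) x :=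
    (S.contDiffAt_freeEnergy hu b hx').differentiableAt (by norm_num)
  have h (j : Fin n) :
      pd j (fun y => -Real.log (u y) - 1 - α - b * H y - ∑ k, μ k * C k y) x
        = -pd j (fun y => Real.log (u y) + b * H y) x - ∑ k, μ k * pd j (C k) x := by
    have he : (fun y => -Real.log (u y) - 1 - α - b * H y - ∑ k, μ k * C k y)
        = fun y => -((Real.log (u y) + b * H y) + (1 + α)) - ∑ k, μ k * C k y := by
      ext y
      ring
    have hn : DifferentiableAt ℝ (fun y => -((Real.log (u y) + b * H y) + (1 + α))) x :=
      (hw.add_const _).neg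
    rw [he, pd_sub hn (DifferentiableAt.fun_sum fun k _ => (hC1 k).const_mul _),
      pd_neg, pd_add hw (differentiableAt_const _), pd_const, add_zero,
      pd_sum fun k _ => (hC1 k).const_mul _]
    simp only [pd_const_mul (hC1 _)]
  -- the Casimirs contribute `μₖ 𝒥ⁱʲ Cᵏⱼ = 0`
  have hzero : ∑ j, 𝒥 x i j * ∑ k, μ k * pd j (C k) x = 0 := by
    simp only [Finset.mul_sum]
    rw [Finset.sum_comm]
    refine Finset.sum_eq_zero fun k _ => ?_
    rw [← mul_zero (μ k), ← hCas k x hx i, Finset.mul_sum]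
    exact Finset.sum_congr rfl fun j _ => by ring
  simp only [h, mul_sub, Finset.sum_sub_distrib, hzero, mul_neg, Finset.sum_neg_distrib, sub_zero]

/-- The bracket `{F, E} + [F, Σ]` is the transport of `δF/δf` along the velocity field `Z`. -/
lemma metriplecticBracket_eq (S : IsInvariantSystem Ω ρ 𝒥 H) (hu : IsC2Density Ω u)
    (hC : ∀ k, CkUpTo ⊤ Ω (C k)) (hCas : ∀ k, IsMicroCasimir Ω 𝒥 (C k)) (D α b : ℝ)
    (μ : Fin m → ℝ) (hg : HasFunctionalDeriv Ω F u g) :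
    metriplecticBracket Ω 𝒥 D F (totalEnergy Ω H) (constrainedEntropy Ω H C α b μ) u
      = ∫ x in Ω, u x * ∑ i, pd i g x * fpVelocity 𝒥 H D b u x i := by
  have hE : HasFunctionalDeriv Ω (totalEnergy Ω H) u H :=
    hasFunctionalDeriv_linearObs S.domain hu.isDensity S.hamiltonian
  have hent := hasFunctionalDeriv_constrainedEntropy S.domain hu.isDensity S.hamiltonian hC α b μ
  have hpd {k : Pt n → ℝ} (hk : CkUpTo 1 Ω k) (x : Pt n) (hx : x ∈ closure Ω) (i : Fin n) :
      ContinuousAt (pd i k) x :=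
    (contDiffAt_pd (k := 0) (hk.contDiffAt hx) (by norm_num) i).continuousAt
  rw [metriplecticBracket, poissonBracket_eq S.domain hg hE,
    dissipativeBracket_eq S.domain hg hent, ← integral_const_mul, ← integral_add]
  · refine setIntegral_congr_fun S.domain.isOpen.measurableSet fun x hx => ?_
    simp only [sum_mul_fpVelocity, S.poisson.sum_dissTensor hx,
      S.sum_mul_pd_constrainedEntropyDeriv hu hC hCas α b μ hx, mul_neg, Finset.sum_neg_distrib]
    ring
  · exact S.domain.integrableOn fun x hx => (hu.continuousAt hx).mul <|
      tendsto_finsetSum _ fun i _ => tendsto_finsetSum _ fun j _ =>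
        ((hpd hg.1 x hx i).mul (S.contDiffAt_tensor 1 hx i j).continuousAt).mul (hpd hE.1 x hx j)
  · exact (S.domain.integrableOn fun x hx => (hu.continuousAt hx).mul <|
      tendsto_finsetSum _ fun i _ => tendsto_finsetSum _ fun j _ =>
        ((hpd hg.1 x hx i).mul (S.contDiffAt_dissTensor hx i j).continuousAt).mul
          (hpd hent.1 x hx j)).const_mul _

lemma metriplecticBracket_eq_integral_fpRHS (S : IsInvariantSystem Ω ρ 𝒥 H)
    (hu : IsC2Density Ω u) (hC : ∀ k, CkUpTo ⊤ Ω (C k)) (hCas : ∀ k, IsMicroCasimir Ω 𝒥 (C k))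
    (α : ℝ) (μ : Fin m → ℝ) (hc : 2 * c = D * b)
    (hbc : ∀ x ∈ frontier Ω, inner ℝ (fpVelocity 𝒥 H D b u x) (outwardNormal ρ x) = 0)
    (hg : HasFunctionalDeriv Ω F u g) :
    metriplecticBracket Ω 𝒥 D F (totalEnergy Ω H) (constrainedEntropy Ω H C α b μ) u
      = ∫ x in Ω, fpRHS 𝒥 H D c u x * g x := by
  rw [S.metriplecticBracket_eq hu hC hCas D α b μ hg,
    S.integral_fpRHS_mul hu hc hbc fun x hx => hg.1.contDiffAt hx]

/-! ### Energy and entropy production -/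

lemma metriplecticBracket_energy (S : IsInvariantSystem Ω ρ 𝒥 H) (hu : IsC2Density Ω u)
    (hC : ∀ k, CkUpTo ⊤ Ω (C k)) (hCas : ∀ k, IsMicroCasimir Ω 𝒥 (C k)) (D α b : ℝ)
    (μ : Fin m → ℝ) :
    metriplecticBracket Ω 𝒥 D (totalEnergy Ω H) (totalEnergy Ω H)
      (constrainedEntropy Ω H C α b μ) u = energyRate Ω 𝒥 H D b u := by
  have hE : HasFunctionalDeriv Ω (totalEnergy Ω H) u H :=
    hasFunctionalDeriv_linearObs S.domain hu.isDensity S.hamiltonian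
  rw [S.metriplecticBracket_eq hu hC hCas D α b μ hE, energyRate, ← integral_const_mul]
  refine setIntegral_congr_fun S.domain.isOpen.measurableSet fun x hx => ?_
  simp only [sum_mul_fpVelocity, S.poisson.sum_sum_mul_self hx fun i => pd i H x]
  ring

/-- Liouville's theorem: `div ẋ = 0`, by the invariance of the measure and antisymmetry. -/
lemma sum_pd_velocity (S : IsInvariantSystem Ω ρ 𝒥 H) (hx : x ∈ Ω) :
    ∑ i, pd i (fun y => velocity 𝒥 H y i) x = 0 := by
  have hx' := subset_closure hx
  have h1 (i j : Fin n) : DifferentiableAt ℝ (fun y => 𝒥 y i j) x :=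
    (S.contDiffAt_tensor 1 hx' i j).differentiableAt (by norm_num)
  have h2 (j : Fin n) : DifferentiableAt ℝ (pd j H) x :=
    (S.contDiffAt_pd_hamiltonian hx' j).differentiableAt (by norm_num)
  have h3 (i : Fin n) : pd i (fun y => velocity 𝒥 H y i) x
      = ∑ j, 𝒥 x i j * pd i (pd j H) x + ∑ j, pd j H x * pd i (fun y => 𝒥 y i j) x := by
    rw [← Finset.sum_add_distrib]
    change pd i (fun y => ∑ j, 𝒥 y i j * pd j H y) x = _
    rw [pd_sum (g := fun j y => 𝒥 y i j * pd j H y) fun j _ => (h1 i j).mul (h2 j)]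
    exact Finset.sum_congr rfl fun j _ => pd_mul (h1 i j) (h2 j) i
  have h4 : ∑ i, ∑ j, pd j H x * pd i (fun y => 𝒥 y i j) x = 0 := by
    rw [Finset.sum_comm]
    simp only [← Finset.mul_sum, S.divFree x hx, mul_zero, Finset.sum_const_zero]
  have h5 : ∑ i, ∑ j, 𝒥 x i j * pd i (pd j H) x
      = -∑ i, ∑ j, 𝒥 x i j * pd i (pd j H) x := by
    conv_lhs => rw [Finset.sum_comm]
    simp only [← Finset.sum_neg_distrib]
    refine Finset.sum_congr rfl fun i _ => Finset.sum_congr rfl fun j _ => ?_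
    rw [S.poisson.antisymm x hx j i, pd_comm (S.contDiffAt_hamiltonian 2 hx') j i]
    ring
  simp only [h3, Finset.sum_add_distrib, h4, add_zero]
  linarith

/-- The Hamiltonian flow does not change the entropy: `∫ ẋ · ∇u = 0`. -/
lemma integral_sum_velocity_mul_pd (S : IsInvariantSystem Ω ρ 𝒥 H) (hu : IsC2Density Ω u)
    (hbc : ∀ x ∈ frontier Ω, inner ℝ (velocity 𝒥 H x) (outwardNormal ρ x) = 0) :
    ∫ x in Ω, ∑ i, velocity 𝒥 H x i * pd i u x = 0 := by
  have hdiv := S.domain.integral_div_eq_zero (W := fun i y => u y * velocity 𝒥 H y i)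
    (fun i x hx => ((hu.contDiffAt x hx).of_le (by norm_num)).mul (S.contDiffAt_velocity hx i))
    fun x hx => by
      have h := S.domain.sum_mul_pd_eq_zero hx (hbc x hx)
      calc _ = u x * ∑ i, velocity 𝒥 H x i * pd i ρ x := by
            rw [Finset.mul_sum]
            exact Finset.sum_congr rfl fun i _ => by ring
        _ = 0 := by rw [h, mul_zero]
  rw [← hdiv]
  refine setIntegral_congr_fun S.domain.isOpen.measurableSet fun x hx => ?_
  have hx' := subset_closure hx
  have h (i : Fin n) : pd i (fun y => u y * velocity 𝒥 H y i) x
      = u x * pd i (fun y => velocity 𝒥 H y i) x + velocity 𝒥 H x i * pd i u x :=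
    pd_mul (hu.differentiableAt hx')
      ((S.contDiffAt_velocity hx' i).differentiableAt (by norm_num)) i
  simp only [h, Finset.sum_add_distrib, ← Finset.mul_sum, S.sum_pd_velocity hx, mul_zero, zero_add]

lemma metriplecticBracket_constrainedEntropy (S : IsInvariantSystem Ω ρ 𝒥 H)
    (hu : IsC2Density Ω u) (hC : ∀ k, CkUpTo ⊤ Ω (C k))
    (hCas : ∀ k, IsMicroCasimir Ω 𝒥 (C k)) (D α b : ℝ) (μ : Fin m → ℝ)
    (hbc : ∀ x ∈ frontier Ω, inner ℝ (velocity 𝒥 H x) (outwardNormal ρ x) = 0) :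
    metriplecticBracket Ω 𝒥 D (constrainedEntropy Ω H C α b μ) (totalEnergy Ω H)
      (constrainedEntropy Ω H C α b μ) u = entropyRate Ω 𝒥 H D b u := by
  have hsq (i : Fin n) (x : Pt n) (hx : x ∈ closure Ω) : ContinuousAt (fun x =>
      u x * (∑ j, 𝒥 x i j * pd j (fun y => Real.log (u y) + b * H y) x) ^ 2) x := by
    have h : ContinuousAt (fun x =>
        ∑ j, 𝒥 x i j * pd j (fun y => Real.log (u y) + b * H y) x) x :=
      tendsto_finsetSum _ fun j _ => (S.contDiffAt_tensor 1 hx i j).continuousAt.mul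
        (S.contDiffAt_pd_freeEnergy hu b hx j).continuousAt
    exact (hu.continuousAt hx).mul (h.pow 2)
  have hvel (x : Pt n) (hx : x ∈ closure Ω) :
      ContinuousAt (fun x => ∑ i, velocity 𝒥 H x i * pd i u x) x :=
    tendsto_finsetSum _ fun i _ => (S.contDiffAt_velocity hx i).continuousAt.mul
      (hu.continuousAt_pd hx i)
  rw [S.metriplecticBracket_eq hu hC hCas D α b μ (hasFunctionalDeriv_constrainedEntropy S.domain
    hu.isDensity S.hamiltonian hC α b μ), entropyRate,
    ← integral_finsetSum _ fun i _ => S.domain.integrableOn (hsq i), ← integral_const_mul]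
  trans ∫ x in Ω, (1 / 2 * D * ∑ i,
      u x * (∑ j, 𝒥 x i j * pd j (fun y => Real.log (u y) + b * H y) x) ^ 2
      - ∑ i, velocity 𝒥 H x i * pd i u x)
  · refine setIntegral_congr_fun S.domain.isOpen.measurableSet fun x hx => ?_
    have hx' := subset_closure hx
    have h0 := (hu.pos x hx').ne'
    -- `ẋ · ∇(log u + b H) = ẋ · ∇u / u`
    have h2 : u x * ∑ i, pd i H x * ∑ j, 𝒥 x i j * pd j (fun y => Real.log (u y) + b * H y) x
        = -∑ i, velocity 𝒥 H x i * pd i u x := by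
      have h3 := S.poisson.sum_sum_mul_eq_neg hx (fun i => pd i u x) (fun i => pd i H x)
      have h4 := S.poisson.sum_sum_mul_self hx (fun i => pd i H x)
      have h5 : u x * ∑ i, pd i H x * ∑ j, 𝒥 x i j * pd j (fun y => Real.log (u y) + b * H y) x
          = ∑ i, pd i H x * ∑ j, 𝒥 x i j * pd j u x
            + u x * b * ∑ i, ∑ j, pd i H x * 𝒥 x i j * pd j H x := by
        simp only [Finset.mul_sum, ← Finset.sum_add_distrib]
        refine Finset.sum_congr rfl fun i _ => Finset.sum_congr rfl fun j _ => ?_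
        rw [S.pd_freeEnergy hu b hx']
        field_simp
      have h6 : ∑ i, velocity 𝒥 H x i * pd i u x = ∑ i, ∑ j, pd i u x * 𝒥 x i j * pd j H x := by
        simp only [velocity, Finset.sum_mul]
        exact Finset.sum_congr rfl fun i _ => Finset.sum_congr rfl fun j _ => by ring
      rw [h5, h4, h6, h3]
      ring
    have h7 : ∑ i, pd i (fun y => -Real.log (u y) - 1 - α - b * H y - ∑ k, μ k * C k y) x
          * fpVelocity 𝒥 H D b u x i
        = ∑ i, pd i H x * ∑ j, 𝒥 x i j * pd j (fun y => Real.log (u y) + b * H y) x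
          + 1 / 2 * D * ∑ i, (∑ j, 𝒥 x i j * pd j (fun y => Real.log (u y) + b * H y) x) ^ 2 := by
      rw [sum_mul_fpVelocity, S.poisson.sum_sum_mul_eq_neg hx, S.poisson.sum_dissTensor hx]
      simp only [S.sum_mul_pd_constrainedEntropyDeriv hu hC hCas α b μ hx, mul_neg, neg_mul,
        Finset.sum_neg_distrib, pow_two]
      ring
    simp only [h7, ← Finset.mul_sum]
    linear_combination h2
  · rw [integral_sub, S.integral_sum_velocity_mul_pd hu hbc, sub_zero]
    · exact (integrable_finsetSum _ fun i _ => S.domain.integrableOn (hsq i)).const_mul _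
    · exact S.domain.integrableOn hvel

lemma entropyRate_nonneg (hΩ : IsSmoothlyBoundedDomain Ω ρ) (hu : IsC2Density Ω u) (hD : 0 ≤ D)
    (b : ℝ) : 0 ≤ entropyRate Ω 𝒥 H D b u := by
  refine mul_nonneg (by positivity) (Finset.sum_nonneg fun i _ => ?_)
  refine setIntegral_nonneg hΩ.isOpen.measurableSet fun x hx => ?_
  have := (hu.pos x (subset_closure hx)).le
  positivity

lemma betaNum_eq (S : IsInvariantSystem Ω ρ 𝒥 H) (hu : IsC2Density Ω u) :
    betaNum Ω 𝒥 H u = ∑ i, ensembleAvg Ω u (fun x => velocity 𝒥 H x i *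
      ∑ j, 𝒥 x i j * pd j (fun y => Real.log (u y)) x) := by
  have hlog (x : Pt n) (hx : x ∈ closure Ω) : ContDiffAt ℝ 2 (fun y => Real.log (u y)) x :=
    (hu.contDiffAt x hx).log (hu.pos x hx).ne'
  simp only [ensembleAvg]
  rw [← integral_finsetSum]
  · refine setIntegral_congr_fun S.domain.isOpen.measurableSet fun x hx => ?_
    have hx' := subset_closure hx
    have h0 := (hu.pos x hx').ne'
    simp only [S.poisson.sum_dissTensor hx, velocity, pd_log (hu.differentiableAt hx') h0]
    refine Finset.sum_congr rfl fun i _ => ?_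
    rw [mul_left_comm]
    congr 1
    rw [Finset.mul_sum]
    refine Finset.sum_congr rfl fun j _ => ?_
    field_simp
  · intro i _
    exact S.domain.integrableOn fun x hx => (hu.continuousAt hx).mul <|
      (S.contDiffAt_velocity hx i).continuousAt.mul <| tendsto_finsetSum _ fun j _ =>
        (S.contDiffAt_tensor 1 hx i j).continuousAt.mul
          (contDiffAt_pd (k := 1) (hlog x hx) (by norm_num) j).continuousAt

lemma betaDen_eq (S : IsInvariantSystem Ω ρ 𝒥 H) (hu : IsC2Density Ω u) :
    betaDen Ω 𝒥 H u = ∑ i, ensembleAvg Ω u (fun x => velocity 𝒥 H x i ^ 2) := by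
  simp only [ensembleAvg]
  rw [← integral_finsetSum]
  · refine setIntegral_congr_fun S.domain.isOpen.measurableSet fun x hx => ?_
    simp only [S.poisson.sum_dissTensor hx, velocity, Finset.mul_sum (s := Finset.univ) (a := u x),
      pow_two]
  · intro i _
    exact S.domain.integrableOn fun x hx => (hu.continuousAt hx).mul <|
      (S.contDiffAt_velocity hx i).continuousAt.pow 2

lemma energyRate_eq (S : IsInvariantSystem Ω ρ 𝒥 H) (hu : IsC2Density Ω u) (D b : ℝ) :
    energyRate Ω 𝒥 H D b u = -(D / 2) * (betaNum Ω 𝒥 H u + b * betaDen Ω 𝒥 H u) := by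
  have hH (x : Pt n) (hx : x ∈ closure Ω) (i : Fin n) : ContinuousAt (pd i H) x :=
    (S.contDiffAt_pd_hamiltonian hx i).continuousAt
  have hK (x : Pt n) (hx : x ∈ closure Ω) (i j : Fin n) :
      ContinuousAt (fun y => dissTensor 𝒥 y i j) x := (S.contDiffAt_dissTensor hx i j).continuousAt
  rw [energyRate, betaNum, betaDen, ← integral_const_mul b, ← integral_add]
  · congr 1
    refine setIntegral_congr_fun S.domain.isOpen.measurableSet fun x hx => ?_
    have hx' := subset_closure hx
    have h0 := (hu.pos x hx').ne'
    simp only [Finset.mul_sum, ← Finset.sum_add_distrib]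
    refine Finset.sum_congr rfl fun i _ => Finset.sum_congr rfl fun j _ => ?_
    rw [S.pd_freeEnergy hu b hx']
    field_simp
  · exact S.domain.integrableOn fun x hx => tendsto_finsetSum _ fun i _ =>
      tendsto_finsetSum _ fun j _ => ((hH x hx i).mul (hK x hx i j)).mul (hu.continuousAt_pd hx j)
  · exact (S.domain.integrableOn fun x hx => (hu.continuousAt hx).mul <|
      tendsto_finsetSum _ fun i _ => tendsto_finsetSum _ fun j _ =>
        ((hH x hx i).mul (hK x hx i j)).mul (hH x hx j)).const_mul _

end IsInvariantSystem

/-! ### Casimir invariants and evolution along solutions -/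

section Casimir

variable {𝒥 : Pt n → Matrix (Fin n) (Fin n) ℝ} {C : Pt n → ℝ} {F : (Pt n → ℝ) → ℝ}

lemma isMicroCasimir_const (c : ℝ) : IsMicroCasimir Ω 𝒥 fun _ => c := fun x _ i => by simp

lemma isMacroCasimir_poissonBracket (hΩ : IsSmoothlyBoundedDomain Ω ρ)
    (h𝒥 : IsPoissonOperator Ω 𝒥) (hC : IsMicroCasimir Ω 𝒥 C)
    (hF : ∀ u, IsDensity Ω u → HasFunctionalDeriv Ω F u C) :
    IsMacroCasimir Ω (poissonBracket Ω 𝒥) F := fun u hu => by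
  refine ⟨(hF u hu).differentiableAt, fun G hG => ?_⟩
  rw [poissonBracket_eq hΩ (hF u hu) hG.hasFunctionalDeriv]
  refine setIntegral_eq_zero_of_forall_eq_zero fun x hx => ?_
  rw [h𝒥.sum_sum_mul_eq_neg hx]
  simp [hC x hx]

lemma isMacroCasimir_dissipativeBracket (hΩ : IsSmoothlyBoundedDomain Ω ρ)
    (h𝒥 : IsPoissonOperator Ω 𝒥) (hC : IsMicroCasimir Ω 𝒥 C)
    (hF : ∀ u, IsDensity Ω u → HasFunctionalDeriv Ω F u C) (D : ℝ) :
    IsMacroCasimir Ω (dissipativeBracket Ω 𝒥 D) F := fun u hu => by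
  refine ⟨(hF u hu).differentiableAt, fun G hG => ?_⟩
  rw [dissipativeBracket_eq hΩ (hF u hu) hG.hasFunctionalDeriv,
    setIntegral_eq_zero_of_forall_eq_zero, mul_zero]
  intro x hx
  rw [h𝒥.sum_dissTensor hx]
  simp [hC x hx]

end Casimir

namespace IsInvariantSystem

variable {𝒥 : Pt n → Matrix (Fin n) (Fin n) ℝ} {H : Pt n → ℝ} {D b c t : ℝ}
  {f : ℝ → Pt n → ℝ} {m : ℕ} {C : Fin m → Pt n → ℝ}

lemma isFieldBracket_fpRHS (S : IsInvariantSystem Ω ρ 𝒥 H) {u : Pt n → ℝ}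
    (hu : IsC2Density Ω u) (hC : ∀ k, CkUpTo ⊤ Ω (C k))
    (hCas : ∀ k, IsMicroCasimir Ω 𝒥 (C k)) (α : ℝ) (μ : Fin m → ℝ) (hc : 2 * c = D * b)
    (hbc : ∀ x ∈ frontier Ω, inner ℝ (fpVelocity 𝒥 H D b u x) (outwardNormal ρ x) = 0) :
    IsFieldBracket Ω 𝒥 D (totalEnergy Ω H) (constrainedEntropy Ω H C α b μ) u
      (fpRHS 𝒥 H D c u) := fun _ hφ =>
  S.metriplecticBracket_eq_integral_fpRHS hu hC hCas α μ hc hbc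
    (hasFunctionalDeriv_linearObs S.domain hu.isDensity hφ)

lemma solvesFPAt_iff_isFieldBracket (S : IsInvariantSystem Ω ρ 𝒥 H) (hft : IsC1FamilyAt Ω f t)
    (hu : IsC2Density Ω (f t)) (hC : ∀ k, CkUpTo ⊤ Ω (C k))
    (hCas : ∀ k, IsMicroCasimir Ω 𝒥 (C k)) (α : ℝ) (μ : Fin m → ℝ) (hc : 2 * c = D * b)
    (hbc : ∀ x ∈ frontier Ω, inner ℝ (fpVelocity 𝒥 H D b (f t) x) (outwardNormal ρ x) = 0) :
    SolvesFPAt Ω 𝒥 H D c f t ↔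
      IsFieldBracket Ω 𝒥 D (totalEnergy Ω H) (constrainedEntropy Ω H C α b μ) (f t)
        (fun x => deriv (fun s => f s x) t) := by
  have hB := S.isFieldBracket_fpRHS hu hC hCas α μ hc hbc
  constructor
  · intro hs φ hφ
    rw [hB φ hφ]
    exact setIntegral_congr_fun S.domain.isOpen.measurableSet fun x hx => by
      simp only [(hs x hx).deriv]
  · intro hw x hx
    have heq := S.domain.eqOn_of_integral_mul_eq (fun x hx => hft.continuousAt_deriv hx)
      (fun x hx => S.continuousAt_fpRHS hu D c hx) fun φ hφ => (hw φ hφ).symm.trans (hB φ hφ)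
    exact (hft.hasDerivAt (subset_closure hx)).congr_deriv (heq hx)

lemma isFieldBracket_deriv_iff (S : IsInvariantSystem Ω ρ 𝒥 H) (hft : IsC1FamilyAt Ω f t)
    {G K : (Pt n → ℝ) → ℝ} :
    IsFieldBracket Ω 𝒥 D G K (f t) (fun x => deriv (fun s => f s x) t) ↔
      ∀ φ, CkUpTo ⊤ Ω φ → HasDerivAt (fun s => linearObs Ω φ (f s))
        (metriplecticBracket Ω 𝒥 D (linearObs Ω φ) G K (f t)) t := by
  have hd {φ : Pt n → ℝ} (hφ : CkUpTo ⊤ Ω φ) := hft.hasDerivAt_linearObs S.domain (φ := φ)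
    fun x hx => (hφ.contDiffAt hx).of_le (by exact_mod_cast le_top)
  exact ⟨fun hw φ hφ => (hd hφ).congr_deriv (hw φ hφ).symm,
    fun hw φ hφ => (hw φ hφ).unique (hd hφ)⟩

lemma hasDerivAt_constrainedEntropy (S : IsInvariantSystem Ω ρ 𝒥 H) (hft : IsC1FamilyAt Ω f t)
    (hu : IsC2Density Ω (f t)) (hC : ∀ k, CkUpTo ⊤ Ω (C k))
    (hCas : ∀ k, IsMicroCasimir Ω 𝒥 (C k)) (α : ℝ) (μ : Fin m → ℝ) (hc : 2 * c = D * b)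
    (hbc : ∀ x ∈ frontier Ω, inner ℝ (fpVelocity 𝒥 H D b (f t) x) (outwardNormal ρ x) = 0)
    (hs : SolvesFPAt Ω 𝒥 H D c f t) :
    HasDerivAt (fun s => constrainedEntropy Ω H C α b μ (f s))
      (metriplecticBracket Ω 𝒥 D (constrainedEntropy Ω H C α b μ) (totalEnergy Ω H)
        (constrainedEntropy Ω H C α b μ) (f t)) t := by
  refine (hft.hasDerivAt_constrainedEntropy S.domain hu.pos S.hamiltonian hC α b μ).congr_deriv ?_
  rw [S.metriplecticBracket_eq_integral_fpRHS hu hC hCas α μ hc hbc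
    (hasFunctionalDeriv_constrainedEntropy S.domain hu.isDensity S.hamiltonian hC α b μ)]
  exact setIntegral_congr_fun S.domain.isOpen.measurableSet fun x hx => by
    simp only [(hs x hx).deriv]

end IsInvariantSystem

lemma entropy_eq_constrainedEntropy_add {m : ℕ} (Ω : Set (Pt n)) (H : Pt n → ℝ)
    (C : Fin m → Pt n → ℝ) (α b : ℝ) (μ : Fin m → ℝ) (u : Pt n → ℝ) :
    entropy Ω u = constrainedEntropy Ω H C α b μ u + α * totalNumber Ω u
      + b * totalEnergy Ω H u + ∑ k, μ k * totalCasimir Ω (C k) u := by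
  rw [constrainedEntropy]
  ring

end FokkerPlanck

theorem mainTheorem1 {n m : ℕ}
    (Ω : Set (FokkerPlanck.Pt n)) (ρ : FokkerPlanck.Pt n → ℝ)
    (hΩ : FokkerPlanck.IsSmoothlyBoundedDomain Ω ρ)
    (𝒥 : FokkerPlanck.Pt n → Matrix (Fin n) (Fin n) ℝ)
    (h𝒥 : FokkerPlanck.IsPoissonOperator Ω 𝒥)
    (hinv : FokkerPlanck.IsDivFree Ω 𝒥)
    (H : FokkerPlanck.Pt n → ℝ) (hH : FokkerPlanck.CkUpTo ⊤ Ω H)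
    (C : Fin m → FokkerPlanck.Pt n → ℝ) (hC : ∀ k, FokkerPlanck.CkUpTo ⊤ Ω (C k))
    (hCas : ∀ k, FokkerPlanck.IsMicroCasimir Ω 𝒥 (C k))
    (D : ℝ) (hD : 0 ≤ D)
    (α : ℝ) (μ : Fin m → ℝ)
    (T : Set ℝ) (hT : IsOpen T)
    (β γ : ℝ → ℝ)
    -- `β = 2 γ / D`
    (hβ : ∀ t ∈ T, 2 * γ t = D * β t)
    (f : ℝ → FokkerPlanck.Pt n → ℝ)
    (hf : ∃ U : Set (FokkerPlanck.Pt n), IsOpen U ∧ closure Ω ⊆ U ∧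
      ContDiffOn ℝ 2 (fun p : ℝ × FokkerPlanck.Pt n => f p.1 p.2) (T ×ˢ U))
    (hpos : ∀ t ∈ T, ∀ x ∈ closure Ω, 0 < f t x)
    (hbc₁ : ∀ x ∈ frontier Ω,
      inner ℝ (FokkerPlanck.velocity 𝒥 H x) (FokkerPlanck.outwardNormal ρ x) = 0)
    (hbc₂ : ∀ t ∈ T, ∀ x ∈ frontier Ω,
      inner ℝ (FokkerPlanck.fpVelocity 𝒥 H D (β t) (f t) x)
        (FokkerPlanck.outwardNormal ρ x) = 0) :
    -- the functional derivatives at every density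
    (∀ u, FokkerPlanck.IsDensity Ω u →
      FokkerPlanck.HasFunctionalDeriv Ω (FokkerPlanck.totalNumber Ω) u (fun _ => 1) ∧
      FokkerPlanck.HasFunctionalDeriv Ω (FokkerPlanck.totalEnergy Ω H) u H ∧
      (∀ k, FokkerPlanck.HasFunctionalDeriv Ω (FokkerPlanck.totalCasimir Ω (C k)) u (C k)) ∧
      (∀ φ, FokkerPlanck.CkUpTo ⊤ Ω φ →
        FokkerPlanck.HasFunctionalDeriv Ω (FokkerPlanck.linearObs Ω φ) u φ) ∧
      ∀ b : ℝ, FokkerPlanck.HasFunctionalDeriv Ω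
        (FokkerPlanck.constrainedEntropy Ω H C α b μ) u
        (fun x => -Real.log (u x) - 1 - α - b * H x - ∑ k, μ k * C k x)) ∧
    -- `N` and the total Casimirs are Casimir invariants of both brackets
    (FokkerPlanck.IsMacroCasimir Ω (FokkerPlanck.poissonBracket Ω 𝒥)
        (FokkerPlanck.totalNumber Ω) ∧
      FokkerPlanck.IsMacroCasimir Ω (FokkerPlanck.dissipativeBracket Ω 𝒥 D)
        (FokkerPlanck.totalNumber Ω) ∧
      ∀ k, FokkerPlanck.IsMacroCasimir Ω (FokkerPlanck.poissonBracket Ω 𝒥)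
          (FokkerPlanck.totalCasimir Ω (C k)) ∧
        FokkerPlanck.IsMacroCasimir Ω (FokkerPlanck.dissipativeBracket Ω 𝒥 D)
          (FokkerPlanck.totalCasimir Ω (C k))) ∧
    ∀ t ∈ T,
      -- `(f, E, Σ)` is the right-hand side of the Fokker–Planck equation
      FokkerPlanck.IsFieldBracket Ω 𝒥 D (FokkerPlanck.totalEnergy Ω H)
        (FokkerPlanck.constrainedEntropy Ω H C α (β t) μ) (f t)
        (FokkerPlanck.fpRHS 𝒥 H D (γ t) (f t)) ∧
      -- the Fokker–Planck equation is `∂f/∂t = (f, E, Σ)`, as an identity of distributions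
      (FokkerPlanck.SolvesFPAt Ω 𝒥 H D (γ t) f t ↔
        FokkerPlanck.IsFieldBracket Ω 𝒥 D (FokkerPlanck.totalEnergy Ω H)
          (FokkerPlanck.constrainedEntropy Ω H C α (β t) μ) (f t)
          (fun x => deriv (fun s => f s x) t)) ∧
      (FokkerPlanck.SolvesFPAt Ω 𝒥 H D (γ t) f t ↔
        ∀ φ, FokkerPlanck.CkUpTo ⊤ Ω φ →
          HasDerivAt (fun s => FokkerPlanck.linearObs Ω φ (f s))
            (FokkerPlanck.metriplecticBracket Ω 𝒥 D (FokkerPlanck.linearObs Ω φ)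
              (FokkerPlanck.totalEnergy Ω H)
              (FokkerPlanck.constrainedEntropy Ω H C α (β t) μ) (f t)) t) ∧
      -- along solutions: the energy balance and the entropy law
      (FokkerPlanck.SolvesFPAt Ω 𝒥 H D (γ t) f t →
        (HasDerivAt (fun s => FokkerPlanck.totalEnergy Ω H (f s))
            (FokkerPlanck.energyRate Ω 𝒥 H D (β t) (f t)) t ∧
          FokkerPlanck.metriplecticBracket Ω 𝒥 D (FokkerPlanck.totalEnergy Ω H)
            (FokkerPlanck.totalEnergy Ω H)
            (FokkerPlanck.constrainedEntropy Ω H C α (β t) μ) (f t)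
              = FokkerPlanck.energyRate Ω 𝒥 H D (β t) (f t) ∧
          -- the energy is conserved exactly for the inverse temperature below
          (0 < D → FokkerPlanck.betaDen Ω 𝒥 H (f t) ≠ 0 →
            (HasDerivAt (fun s => FokkerPlanck.totalEnergy Ω H (f s)) 0 t ↔
              β t = -(FokkerPlanck.betaNum Ω 𝒥 H (f t) / FokkerPlanck.betaDen Ω 𝒥 H (f t)))) ∧
          FokkerPlanck.betaNum Ω 𝒥 H (f t)
            = ∑ i, FokkerPlanck.ensembleAvg Ω (f t) (fun x =>
                FokkerPlanck.velocity 𝒥 H x i *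
                  ∑ j, 𝒥 x i j * FokkerPlanck.pd j (fun y => Real.log (f t y)) x) ∧
          FokkerPlanck.betaDen Ω 𝒥 H (f t)
            = ∑ i, FokkerPlanck.ensembleAvg Ω (f t) (fun x =>
                FokkerPlanck.velocity 𝒥 H x i ^ 2)) ∧
        -- the time derivative of `Σ` is taken at fixed multipliers
        (HasDerivAt (fun s => FokkerPlanck.constrainedEntropy Ω H C α (β t) μ (f s))
            (FokkerPlanck.entropyRate Ω 𝒥 H D (β t) (f t)) t ∧
          FokkerPlanck.metriplecticBracket Ω 𝒥 D
            (FokkerPlanck.constrainedEntropy Ω H C α (β t) μ)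
            (FokkerPlanck.totalEnergy Ω H)
            (FokkerPlanck.constrainedEntropy Ω H C α (β t) μ) (f t)
              = FokkerPlanck.entropyRate Ω 𝒥 H D (β t) (f t) ∧
          0 ≤ FokkerPlanck.entropyRate Ω 𝒥 H D (β t) (f t) ∧
          (HasDerivAt (fun s => FokkerPlanck.totalEnergy Ω H (f s)) 0 t →
            HasDerivAt (fun s => FokkerPlanck.entropy Ω (f s))
              (FokkerPlanck.entropyRate Ω 𝒥 H D (β t) (f t)) t))) := by
  have S : FokkerPlanck.IsInvariantSystem Ω ρ 𝒥 H := ⟨hΩ, h𝒥, hinv, hH⟩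
  have hnum : ∀ u, FokkerPlanck.IsDensity Ω u →
      FokkerPlanck.HasFunctionalDeriv Ω (FokkerPlanck.totalNumber Ω) u (fun _ => 1) :=
    fun u hu => FokkerPlanck.hasFunctionalDeriv_totalNumber hΩ hu
  have hlin : ∀ φ, FokkerPlanck.CkUpTo ⊤ Ω φ → ∀ u, FokkerPlanck.IsDensity Ω u →
      FokkerPlanck.HasFunctionalDeriv Ω (FokkerPlanck.linearObs Ω φ) u φ :=
    fun φ hφ u hu => FokkerPlanck.hasFunctionalDeriv_linearObs hΩ hu hφ
  have hent : ∀ u, FokkerPlanck.IsDensity Ω u → ∀ b : ℝ, FokkerPlanck.HasFunctionalDeriv Ω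
      (FokkerPlanck.constrainedEntropy Ω H C α b μ) u
      (fun x => -Real.log (u x) - 1 - α - b * H x - ∑ k, μ k * C k x) :=
    fun u hu b => FokkerPlanck.hasFunctionalDeriv_constrainedEntropy hΩ hu hH hC α b μ
  have hNP := FokkerPlanck.isMacroCasimir_poissonBracket hΩ h𝒥
    (FokkerPlanck.isMicroCasimir_const 1) hnum
  have hND := FokkerPlanck.isMacroCasimir_dissipativeBracket hΩ h𝒥
    (FokkerPlanck.isMicroCasimir_const 1) hnum D
  have hCP := fun k => FokkerPlanck.isMacroCasimir_poissonBracket hΩ h𝒥 (hCas k)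
    (hlin (C k) (hC k))
  have hCD := fun k => FokkerPlanck.isMacroCasimir_dissipativeBracket hΩ h𝒥 (hCas k)
    (hlin (C k) (hC k)) D
  refine ⟨fun u hu => ⟨hnum u hu, hlin H hH u hu, fun k => hlin (C k) (hC k) u hu,
    fun φ hφ => hlin φ hφ u hu, hent u hu⟩, ⟨hNP, hND, fun k => ⟨hCP k, hCD k⟩⟩, fun t ht => ?_⟩
  obtain ⟨U, hU, hΩU, hfU⟩ := hf
  have hf2 : ∀ x ∈ closure Ω,
      ContDiffAt ℝ 2 (fun p : ℝ × FokkerPlanck.Pt n => f p.1 p.2) (t, x) := fun x hx =>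
    hfU.contDiffAt ((hT.prod hU).mem_nhds ⟨ht, hΩU hx⟩)
  have hft : FokkerPlanck.IsC1FamilyAt Ω f t := fun x hx => (hf2 x hx).of_le (by norm_num)
  have hu : FokkerPlanck.IsC2Density Ω (f t) :=
    ⟨fun x hx => (hf2 x hx).comp (f := fun y => (t, y)) x
      (contDiffAt_const.prodMk contDiffAt_id), hpos t ht⟩
  have hiff := S.solvesFPAt_iff_isFieldBracket hft hu hC hCas α μ (hβ t ht) (hbc₂ t ht)
  refine ⟨S.isFieldBracket_fpRHS hu hC hCas α μ (hβ t ht) (hbc₂ t ht), hiff,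
    hiff.trans (S.isFieldBracket_deriv_iff hft), fun hs => ?_⟩
  have hobs := (S.isFieldBracket_deriv_iff hft).1 (hiff.1 hs)
  have hEE := S.metriplecticBracket_energy hu hC hCas D α (β t) μ
  have hE := (hobs H hH).congr_deriv hEE
  have hSS := S.metriplecticBracket_constrainedEntropy hu hC hCas D α (β t) μ hbc₁
  have hCE := (S.hasDerivAt_constrainedEntropy hft hu hC hCas α μ (hβ t ht) (hbc₂ t ht)
    hs).congr_deriv hSS
  refine ⟨⟨hE, hEE, fun hD0 hden => ?_, S.betaNum_eq hu, S.betaDen_eq hu⟩, hCE, hSS,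
    FokkerPlanck.IsInvariantSystem.entropyRate_nonneg hΩ hu hD (β t), fun hE0 => ?_⟩
  · have hrate := S.energyRate_eq hu D (β t)
    have h1 : HasDerivAt (fun s => FokkerPlanck.totalEnergy Ω H (f s)) 0 t ↔
        FokkerPlanck.energyRate Ω 𝒥 H D (β t) (f t) = 0 :=
      ⟨fun h => hE.unique h, fun h => h ▸ hE⟩
    rw [h1, hrate, mul_eq_zero, or_iff_right (by linarith), ← neg_div, eq_div_iff hden]
    constructor <;> intro h <;> linarith
  · have hEd : FokkerPlanck.FunctionalDifferentiableAt Ω (FokkerPlanck.totalEnergy Ω H) (f t) :=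
      (hlin H hH _ hu.isDensity).differentiableAt
    have hSd := (hent _ hu.isDensity (β t)).differentiableAt
    -- `S = Σ + α N + β E + μₖ ℭᵏ`, where `N` and `ℭᵏ` are conserved as Casimirs
    have hN0 : HasDerivAt (fun s => FokkerPlanck.totalNumber Ω (f s)) 0 t := by
      have h := hobs (fun _ => 1) (FokkerPlanck.ckUpTo_of_contDiff contDiff_const)
      have hlN : FokkerPlanck.linearObs Ω (fun _ => 1) = FokkerPlanck.totalNumber Ω := by
        ext u
        simp [FokkerPlanck.totalNumber, FokkerPlanck.linearObs]
      rw [hlN] at h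
      refine h.congr_deriv ?_
      rw [FokkerPlanck.metriplecticBracket, (hNP _ hu.isDensity).2 _ hEd,
        (hND _ hu.isDensity).2 _ hSd, add_zero]
    have hC0 (k : Fin m) : HasDerivAt (fun s => FokkerPlanck.totalCasimir Ω (C k) (f s)) 0 t := by
      refine (hobs (C k) (hC k)).congr_deriv ?_
      have h1 := (hCP k _ hu.isDensity).2 _ hEd
      have h2 := (hCD k _ hu.isDensity).2 _ hSd
      rw [FokkerPlanck.metriplecticBracket, h1, h2, add_zero]
    simp only [FokkerPlanck.entropy_eq_constrainedEntropy_add Ω H C α (β t) μ]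
    refine (((hCE.add (hN0.const_mul α)).add (hE0.const_mul (β t))).add
      (HasDerivAt.fun_sum (u := Finset.univ) fun k _ => (hC0 k).const_mul (μ k))).congr_deriv ?_
    simp
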